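/- **Setting.** Let $\Theta\subseteq\mathbb R$ be a non-degenerate interval. For a symmetric kernel $\mathcal K$ on $\Theta^2$ put $g_{\mathcal K}(\theta)=\partial^2_{x,y}\mathcal K(\theta,\theta)$ and, when $g_{\mathcal K}>0$, let $\mathfrak d_{\mathcal K}(\theta,\theta')=|G(\theta)-G(\theta')|$ with $G$ a primitive of $\sqrt{g_{\mathcal K}}$. Let $D_{0,0}[\mathcal K]=\mathcal K$, $D_{i+1,j}[\mathcal K](x,y)=g_{\mathcal K}(x)^{i/2}\,\partial_x\big(D_{i,j}[\mathcal K](x,y)/g_{\mathcal K}(x)^{i/2}\big)$, $D_{i,j}[\mathcal K](x,y)=D_{j,i}[\mathcal K](y,x)$, and $\mathcal K^{[i,j]}(x,y)=D_{i,j}[\mathcal K](x,y)/(g_{\mathcal K}(x)^{i/2}g_{\mathcal K}(y)^{j/2})$, $h_{\mathcal K}(\theta)=\mathcal K^{[3,3]}(\theta,\theta)$. *Limit kernel.* $\mathcal K_\infty$ is a symmetric kernel of class $\mathcal C^{3,3}$ on $\Theta^2$, with $g_\infty=g_{\mathcal K_\infty}$ positive and of class $\mathcal C^2$, and $\mathcal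 K_\infty(\theta,\theta)=-\mathcal K_\infty^{[2,0]}(\theta,\theta)=1$ on $\Theta$; $\Theta_\infty\subseteq\Theta$ is an interval with $\inf_{\Theta_\infty}g_\infty>0$, $L_3=\sup_{\Theta_\infty}h_{\mathcal K_\infty}<\infty$ and $L_{i,j}=\sup_{\Theta_\infty^2}|\mathcal K_\infty^{[i,j]}|<\infty$ for $i,j\in\{0,1,2\}$. *Dictionary.* $H_T$ is a real Hilbert space, $\varphi_T:\Theta\to H_T$ is of class $\mathcal C^3$ and does not vanish; $\phi_T=\varphi_T/\|\varphi_T\|_T$ satisfies $\|\partial_\theta\phi_T(\theta)\|_T>0$ on $\Theta$; $\mathcal K_T(\theta,\theta')=\langle\phi_T(\theta),\phi_T(\theta')\rangle_T$ and $\mathfrak d_T=\mathfrak d_{\mathcal K_T}$. $\Theta_T\subseteq\Theta_\infty$ is a compact interval, with $\mathfrak d_T$-diameter $|\Theta_T|_{\mathfrak d_T}$, on which $\sup_{\Theta_T^2}|\mathcal K_T^{[i,j]}-\mathcal K_\infty^{[i,j]}|$ ($i,j\in\{0,1,2\}$) and $\sup_{\Theta_T}|h_{\mathcal K_T}-h_{\mathcal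 K_\infty}|$ are all at most $\min(L_{2,2},L_3)$. *Model.* $\mathcal Z$ is finite with $n$ elements, $\nu=\sum_{z\in\mathcal Z}a_z\delta_z\neq0$ with $a_z\ge0$, and $Y=B^\star\Phi_T(\vartheta^\star)+W_T$ in $L_T=L^2(\nu,H_T)$, where $B\Phi_T(\vartheta)=\sum_{k=1}^K B_k\,\phi_T(\theta_k)$, $B^\star\in L^2(\nu,\mathbb R^K)$ and $\vartheta^\star=(\theta^\star_k)_{k\le K}\in\Theta_T^K$. Let $S^\star=\{k:\|B^\star_k\|_{L^2(\nu)}\neq0\}$, $s=\operatorname{Card}S^\star\ge1$ and $\mathcal Q^\star=\{\theta_k^\star,\ k\in S^\star\}$, assumed of cardinal $s$. *Noise.* The $(W_T(z))_{z\in\mathcal Z}$ are independent copies of a random element $w_T$ of $H_T$ such that, for some $\sigma,\Delta_T>0$ and every $f\in H_T$, $\langle f,w_T\rangle_T$ is centered Gaussian with variance at most $\sigma^2\Delta_T\|f\|_T^2$. *Certificates.* Let $r>0$ and let $C_N,C_N',C_F,C_B,c_N,c_F,c_B$ be positive constants with $C_F<1$, depending only on $r$ and $\mathcal K_\infty$.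 Distinct points of $\mathcal Q^\star$ are at $\mathfrak d_T$-distance $>2r$, and for every $V:\mathcal Z\times\mathcal Q^\star\to\mathbb R$ with $\|V(\cdot,\theta^\star)\|_{L^\infty(\nu)}=1$ for all $\theta^\star\in\mathcal Q^\star$ there are $P,Q\in L^\infty(\nu,H_T)$ with $\|P\|_{L_T}\le C_B\sqrt{s\,\nu(\mathcal Z)}$, $\|Q\|_{L_T}\le c_B\sqrt{s\,\nu(\mathcal Z)}$ such that, with all norms below those of $L^\infty(\nu)$: (a) for all $\theta^\star\in\mathcal Q^\star$ and $\theta\in\Theta_T$ with $d:=\mathfrak d_T(\theta^\star,\theta)\le r$: $\|\langle\phi_T(\theta),P\rangle_T\|\le1-C_Nd^2$, $\|\langle\phi_T(\theta),P\rangle_T-V(\cdot,\theta^\star)\|\le C_N'd^2$ and $\|\langle\phi_T(\theta),Q\rangle_T-V(\cdot,\theta^\star)\operatorname{sign}(\theta-\theta^\star)\,d\|\le c_Nd^2$; (b) for all $\theta\in\Theta_T$ at $\mathfrak d_T$-distance $>r$ from every point of $\mathcal Q^\star$: $\|\langle\phi_T(\theta),P\rangle_T\|\le1-C_F$ and $\|\langle\phi_T(\theta),Q\rangle_T\|\le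 c_F$. *Estimators.* For $\kappa>0$, $(\hat B,\hat\vartheta)$ is any minimizer over $L^2(\nu,\mathbb R^K)\times\Theta_T^K$ of $$\frac1{2\nu(\mathcal Z)}\|Y-B\Phi_T(\vartheta)\|_{L_T}^2+\kappa\sum_{k=1}^K\|B_k\|_{L^1(\nu)}.$$ **Corollary.** There exist finite positive constants $\mathcal C_0,\mathcal C_3,\mathcal C_4$, depending only on the kernel $\mathcal K_\infty$ (given with $\Theta$ and $\Theta_\infty$), on $r$ and on the certificate constants (which themselves depend only on $r$ and $\mathcal K_\infty$), such that for any $\tau>1$ and any $$\kappa\ge\mathcal C_3\,\sigma\sqrt{\Delta_T\log\tau}\,/\,\nu(\mathcal Z),$$ with probability at least $$1-\mathcal C_4\,n\left(\frac{|\Theta_T|_{\mathfrak d_T}}{\tau\sqrt{\log\tau}}\vee\frac1\tau\right)$$ every such estimator satisfies $$\frac1{\sqrt{\nu(\mathcal Z)}}\big\|\hat B\Phi_T(\hat\vartheta)-B^\star\Phi_T(\vartheta^\star)\big\|_{L_T}\le\mathcal C_0\sqrt s\,\nu(\mathcal Z)\,\kappa .$$ -/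

import Mathlib

open MeasureTheory ProbabilityTheory
open scoped NNReal ENNReal

namespace MixtureModel

noncomputable section

/-! ### Kernels on `Θ × Θ` and their Riemannian derivatives

All derivatives are taken inside the interval `Θ` (one-sided at an end point that belongs to `Θ`). -/

/-- Partial derivative of `F` in the first variable, within `Θ`. -/
def partialX (Θ : Set ℝ) (F : ℝ → ℝ → ℝ) (x y : ℝ) : ℝ := derivWithin (fun t => F t y) Θ x

/-- Partial derivative of `F` in the second variable, within `Θ`. -/
def partialY (Θ : Set ℝ) (F : ℝ → ℝ → ℝ) (x y : ℝ) : ℝ := derivWithin (fun t => F x t) Θ y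

/-- `F` is of class `𝒞^{i,j}` on `Θ × Θ`. -/
def IsClass (Θ : Set ℝ) : ℕ → ℕ → (ℝ → ℝ → ℝ) → Prop
  | 0, 0, F => ContinuousOn (Function.uncurry F) (Θ ×ˢ Θ)
  | i + 1, 0, F =>
      ContinuousOn (Function.uncurry F) (Θ ×ˢ Θ) ∧
      (∀ y ∈ Θ, ContDiffOn ℝ ((i + 1 : ℕ) : WithTop ℕ∞) (fun x => F x y) Θ) ∧
      IsClass Θ i 0 (partialX Θ F)
  | 0, j + 1, F =>
      ContinuousOn (Function.uncurry F) (Θ ×ˢ Θ) ∧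
      (∀ x ∈ Θ, ContDiffOn ℝ ((j + 1 : ℕ) : WithTop ℕ∞) (fun y => F x y) Θ) ∧
      IsClass Θ 0 j (partialY Θ F)
  | i + 1, j + 1, F =>
      ContinuousOn (Function.uncurry F) (Θ ×ˢ Θ) ∧
      (∀ y ∈ Θ, ContDiffOn ℝ ((i + 1 : ℕ) : WithTop ℕ∞) (fun x => F x y) Θ) ∧
      IsClass Θ i (j + 1) (partialX Θ F) ∧
      (∀ x ∈ Θ, ContDiffOn ℝ ((j + 1 : ℕ) : WithTop ℕ∞) (fun y => F x y) Θ) ∧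
      IsClass Θ (i + 1) j (partialY Θ F)
  termination_by i j => i + j

/-- `g_𝒦(θ) = ∂²_{x,y} 𝒦(θ, θ)`. -/
def kernelG (Θ : Set ℝ) (𝒦 : ℝ → ℝ → ℝ) (θ : ℝ) : ℝ := partialX Θ (partialY Θ 𝒦) θ θ

/-- The Riemannian metric `𝔡_𝒦(θ, θ') = |G(θ) - G(θ')|`, with `G` a primitive of `√g_𝒦`. -/
def riemDist (Θ : Set ℝ) (𝒦 : ℝ → ℝ → ℝ) (θ θ' : ℝ) : ℝ :=
  |∫ t in θ'..θ, √(kernelG Θ 𝒦 t)|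

/-- Diameter of `S` for the metric `𝔡_𝒦`. -/
def riemDiam (Θ : Set ℝ) (𝒦 : ℝ → ℝ → ℝ) (S : Set ℝ) : ℝ :=
  sSup (Set.image2 (riemDist Θ 𝒦) S S)

/-- Covariant derivatives `D_{0,j;𝒦}[F]` in the second variable:
`D_{0,j+1}[F](x, y) = g(y)^{j/2} ∂_y (D_{0,j}[F](x, y) / g(y)^{j/2})`. -/
def covDerivY (Θ : Set ℝ) (𝒦 F : ℝ → ℝ → ℝ) : ℕ → ℝ → ℝ → ℝ
  | 0 => F
  | j + 1 => fun x y =>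
      √(kernelG Θ 𝒦 y) ^ j *
        partialY Θ (fun u v => covDerivY Θ 𝒦 F j u v / √(kernelG Θ 𝒦 v) ^ j) x y

/-- Covariant derivatives `D_{i,j;𝒦}[F]`:
`D_{i+1,j}[F](x, y) = g(x)^{i/2} ∂_x (D_{i,j}[F](x, y) / g(x)^{i/2})`. -/
def covDeriv (Θ : Set ℝ) (𝒦 F : ℝ → ℝ → ℝ) : ℕ → ℕ → ℝ → ℝ → ℝ
  | 0, j => covDerivY Θ 𝒦 F j
  | i + 1, j => fun x y =>
      √(kernelG Θ 𝒦 x) ^ i *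
        partialX Θ (fun u v => covDeriv Θ 𝒦 F i j u v / √(kernelG Θ 𝒦 u) ^ i) x y

/-- `𝒦^{[i,j]}(x, y) = D_{i,j;𝒦}[𝒦](x, y) / (g_𝒦(x)^{i/2} g_𝒦(y)^{j/2})`. -/
def kernelDeriv (Θ : Set ℝ) (𝒦 : ℝ → ℝ → ℝ) (i j : ℕ) (x y : ℝ) : ℝ :=
  covDeriv Θ 𝒦 𝒦 i j x y / (√(kernelG Θ 𝒦 x) ^ i * √(kernelG Θ 𝒦 y) ^ j)

/-- `h_𝒦(θ) = 𝒦^{[3,3]}(θ, θ)`. -/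
def kernelH (Θ : Set ℝ) (𝒦 : ℝ → ℝ → ℝ) (θ : ℝ) : ℝ := kernelDeriv Θ 𝒦 3 3 θ θ

/-- `L_{i,j} = sup_{S × S} |𝒦^{[i,j]}|`, as an extended real. -/
def supKernelDeriv (Θ S : Set ℝ) (𝒦 : ℝ → ℝ → ℝ) (i j : ℕ) : EReal :=
  ⨆ x ∈ S, ⨆ y ∈ S, ((|kernelDeriv Θ 𝒦 i j x y| : ℝ) : EReal)

/-- `L_3 = sup_S h_𝒦`, as an extended real. -/
def supKernelH (Θ S : Set ℝ) (𝒦 : ℝ → ℝ → ℝ) : EReal := ⨆ x ∈ S, ((kernelH Θ 𝒦 x : ℝ) : EReal)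

/-- Properties of the limit kernel `𝒦∞` on `Θ × Θ` and of the interval `Θ∞ ⊆ Θ`. -/
structure IsLimitKernel (Θ Θinf : Set ℝ) (Kinf : ℝ → ℝ → ℝ) : Prop where
  symm : ∀ x ∈ Θ, ∀ y ∈ Θ, Kinf x y = Kinf y x
  isClass : IsClass Θ 3 3 Kinf
  g_pos : ∀ θ ∈ Θ, 0 < kernelG Θ Kinf θ
  g_contDiffOn : ContDiffOn ℝ 2 (kernelG Θ Kinf) Θ
  diag : ∀ θ ∈ Θ, Kinf θ θ = 1
  diag_two_zero : ∀ θ ∈ Θ, kernelDeriv Θ Kinf 2 0 θ θ = -1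
  subset : Θinf ⊆ Θ
  ordConnected : Θinf.OrdConnected
  inf_g_pos : 0 < ⨅ θ ∈ Θinf, ((kernelG Θ Kinf θ : ℝ) : EReal)
  supH_lt_top : supKernelH Θ Θinf Kinf < ⊤
  supDeriv_lt_top : ∀ i ≤ 2, ∀ j ≤ 2, supKernelDeriv Θ Θinf Kinf i j < ⊤

/-! ### The dictionary and its kernel -/

section Dictionary

variable {H : Type*} [NormedAddCommGroup H] [InnerProductSpace ℝ H]

/-- Normalized features `ϕ(θ) = φ(θ) / ‖φ(θ)‖`. -/
def normFeature (φ : ℝ → H) (θ : ℝ) : H := (‖φ θ‖)⁻¹ • φ θ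

/-- The kernel of the dictionary, `𝒦_T(θ, θ') = ⟨ϕ(θ), ϕ(θ')⟩`. -/
def featureKernel (φ : ℝ → H) (θ θ' : ℝ) : ℝ := inner ℝ (normFeature φ θ) (normFeature φ θ')

/-- Regularity of the dictionary: `φ` is `𝒞³` on `Θ`, does not vanish, and
`g_T(θ) = ‖∂_θ ϕ(θ)‖²` is positive on `Θ`. -/
structure IsRegularDictionary (Θ : Set ℝ) (φ : ℝ → H) : Prop where
  contDiffOn : ContDiffOn ℝ 3 φ Θ
  norm_pos : ∀ θ ∈ Θ, 0 < ‖φ θ‖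
  g_pos : ∀ θ ∈ Θ, 0 < ‖derivWithin (normFeature φ) Θ θ‖ ^ 2

/-- `𝒱_T`: the distance between the kernels `𝒦` and `𝒦∞` on `ΘT`, as an extended real. -/
def approxError (Θ ΘT : Set ℝ) (𝒦 Kinf : ℝ → ℝ → ℝ) : EReal :=
  max
    (⨆ i ∈ Set.Iic (2 : ℕ), ⨆ j ∈ Set.Iic (2 : ℕ), ⨆ x ∈ ΘT, ⨆ y ∈ ΘT,
      ((|kernelDeriv Θ 𝒦 i j x y - kernelDeriv Θ Kinf i j x y| : ℝ) : EReal))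
    (⨆ x ∈ ΘT, ((|kernelH Θ 𝒦 x - kernelH Θ Kinf x| : ℝ) : EReal))

/-- Proximity of the kernel of the dictionary to the limit kernel on the compact interval `ΘT`:
`𝒱_T ≤ min(L_{2,2}, L_3)`. -/
structure IsCloseToLimit (Θ Θinf ΘT : Set ℝ) (Kinf : ℝ → ℝ → ℝ) (φ : ℝ → H) : Prop where
  isCompact : IsCompact ΘT
  ordConnected : ΘT.OrdConnected
  subset : ΘT ⊆ Θinf
  error_le : approxError Θ ΘT (featureKernel φ) Kinf ≤
    min (supKernelDeriv Θ Θinf Kinf 2 2) (supKernelH Θ Θinf Kinf)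

end Dictionary

/-! ### Norms, certificates, estimators -/

section Model

variable {H : Type*} [NormedAddCommGroup H] [InnerProductSpace ℝ H]
variable {Z : Type*} [MeasurableSpace Z]

/-- The norm of `L^p(ν, E)`. -/
def lpn {E : Type*} [NormedAddCommGroup E] (ν : Measure Z) (p : ℝ≥0∞) (f : Z → E) : ℝ :=
  (eLpNorm f p ν).toReal

/-- `𝒬` is a `2r`-separated subset of `ΘT` of cardinal `s`, for the metric of the dictionary. -/
structure IsSeparated (Θ ΘT : Set ℝ) (φ : ℝ → H) (r : ℝ) (s : ℕ) (𝒬 : Set ℝ) : Prop where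
  subset : 𝒬 ⊆ ΘT
  finite : 𝒬.Finite
  ncard_eq : 𝒬.ncard = s
  separated : ∀ θ ∈ 𝒬, ∀ θ' ∈ 𝒬, θ ≠ θ' → 2 * r < riemDist Θ (featureKernel φ) θ θ'

/-- Interpolating certificates, with constants `C_N, C_N', C_F, C_B`. -/
def HasInterpolatingCertificates (Θ ΘT : Set ℝ) (φ : ℝ → H) (ν : Measure Z) (p q : ℝ≥0∞)
    (r : ℝ) (s : ℕ) (𝒬 : Set ℝ) (CN CN' CF CB : ℝ) : Prop :=
  IsSeparated Θ ΘT φ r s 𝒬 ∧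
  ∀ V : Z → ℝ → ℝ, (∀ θs ∈ 𝒬, Measurable (fun z => V z θs)) →
    (∀ θs ∈ 𝒬, eLpNorm (fun z => V z θs) q ν = 1) →
    ∃ P : Z → H, MemLp P q ν ∧
      (∀ θs ∈ 𝒬, ∀ θ ∈ ΘT, riemDist Θ (featureKernel φ) θs θ ≤ r →
        lpn ν q (fun z => (inner ℝ (normFeature φ θ) (P z) : ℝ)) ≤
          1 - CN * riemDist Θ (featureKernel φ) θs θ ^ 2) ∧
      (∀ θs ∈ 𝒬, ∀ θ ∈ ΘT, riemDist Θ (featureKernel φ) θs θ ≤ r →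
        lpn ν q (fun z => (inner ℝ (normFeature φ θ) (P z) : ℝ) - V z θs) ≤
          CN' * riemDist Θ (featureKernel φ) θs θ ^ 2) ∧
      (∀ θ ∈ ΘT, (∀ θs ∈ 𝒬, r < riemDist Θ (featureKernel φ) θs θ) →
        lpn ν q (fun z => (inner ℝ (normFeature φ θ) (P z) : ℝ)) ≤ 1 - CF) ∧
      lpn ν 2 P ≤ CB * √(s : ℝ) * ν.real Set.univ ^ ((p⁻¹).toReal / 2 - (q⁻¹).toReal / 2)

/-- Interpolating derivative certificates, with constants `c_N, c_F, c_B`. -/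
def HasDerivativeCertificates (Θ ΘT : Set ℝ) (φ : ℝ → H) (ν : Measure Z) (p q : ℝ≥0∞)
    (r : ℝ) (s : ℕ) (𝒬 : Set ℝ) (cN cF cB : ℝ) : Prop :=
  IsSeparated Θ ΘT φ r s 𝒬 ∧
  ∀ V : Z → ℝ → ℝ, (∀ θs ∈ 𝒬, Measurable (fun z => V z θs)) →
    (∀ θs ∈ 𝒬, eLpNorm (fun z => V z θs) q ν = 1) →
    ∃ Q : Z → H, MemLp Q q ν ∧
      (∀ θs ∈ 𝒬, ∀ θ ∈ ΘT, riemDist Θ (featureKernel φ) θs θ ≤ r →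
        lpn ν q (fun z => (inner ℝ (normFeature φ θ) (Q z) : ℝ) -
            V z θs * Real.sign (θ - θs) * riemDist Θ (featureKernel φ) θ θs) ≤
          cN * riemDist Θ (featureKernel φ) θs θ ^ 2) ∧
      (∀ θ ∈ ΘT, (∀ θs ∈ 𝒬, r < riemDist Θ (featureKernel φ) θs θ) →
        lpn ν q (fun z => (inner ℝ (normFeature φ θ) (Q z) : ℝ)) ≤ cF) ∧
      lpn ν 2 Q ≤ cB * √(s : ℝ) * ν.real Set.univ ^ ((p⁻¹).toReal / 2 - (q⁻¹).toReal / 2)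

/-- The mixture `z ↦ B(z) Φ(ϑ) = ∑ₖ Bₖ(z) ϕ(θₖ)`. -/
def mixture {K : ℕ} (φ : ℝ → H) (B : Fin K → Z → ℝ) (ϑ : Fin K → ℝ) (z : Z) : H :=
  ∑ k, B k z • normFeature φ (ϑ k)

/-- The support `S⋆ = {k, ‖Bₖ‖_{L²(ν)} ≠ 0}`. -/
def support {K : ℕ} (ν : Measure Z) (B : Fin K → Z → ℝ) : Set (Fin K) :=
  {k | eLpNorm (B k) 2 ν ≠ 0}

/-- The penalized risk
`(2 ν(𝒵))⁻¹ ‖Y - B Φ(ϑ)‖²_{L²(ν, H)} + κ ∑ₖ ‖Bₖ‖_{L^p(ν)}`. -/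
def penalizedRisk {K : ℕ} (φ : ℝ → H) (ν : Measure Z) (p : ℝ≥0∞) (κ : ℝ) (Y : Z → H)
    (B : Fin K → Z → ℝ) (ϑ : Fin K → ℝ) : ℝ :=
  1 / (2 * ν.real Set.univ) * lpn ν 2 (fun z => Y z - mixture φ B ϑ z) ^ 2 +
    κ * ∑ k, lpn ν p (B k)

/-- `(B, ϑ)` minimizes the penalized risk over `L²(ν, ℝ^K) × ΘT^K`. -/
def IsEstimator {K : ℕ} (ΘT : Set ℝ) (φ : ℝ → H) (ν : Measure Z) (p : ℝ≥0∞) (κ : ℝ)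
    (Y : Z → H) (B : Fin K → Z → ℝ) (ϑ : Fin K → ℝ) : Prop :=
  (∀ k, MemLp (B k) 2 ν) ∧ (∀ k, ϑ k ∈ ΘT) ∧
  ∀ (B' : Fin K → Z → ℝ) (ϑ' : Fin K → ℝ), (∀ k, MemLp (B' k) 2 ν) → (∀ k, ϑ' k ∈ ΘT) →
    penalizedRisk φ ν p κ Y B ϑ ≤ penalizedRisk φ ν p κ Y B' ϑ'

end Model

/-- Admissible noise: the `W(z)` are independent copies of a noise `w` with values in `H` such that
every `⟨f, w⟩` is a centered Gaussian variable of variance at most `σ² Δ ‖f‖²`. A random element `x`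
of `H` is seen as the real process `(⟨f, x⟩)_{f ∈ H}`; if `H` is separable, the product `σ`-algebra
on these processes is the Borel `σ`-algebra of `H`. -/
def IsAdmissibleNoise {Ω H Z : Type*} [MeasurableSpace Ω] [NormedAddCommGroup H]
    [InnerProductSpace ℝ H] (μ : Measure Ω) (W : Ω → Z → H) (σ Δ : ℝ) : Prop :=
  ∃ w : Ω → H,
    (∀ f : H, Measurable (fun ω => (inner ℝ f (w ω) : ℝ))) ∧
    (∀ z, ∀ f : H, Measurable (fun ω => (inner ℝ f (W ω z) : ℝ))) ∧
    iIndepFun (fun (z : Z) (ω : Ω) (f : H) => (inner ℝ f (W ω z) : ℝ)) μ ∧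
    (∀ z, IdentDistrib (fun (ω : Ω) (f : H) => (inner ℝ f (W ω z) : ℝ))
      (fun (ω : Ω) (f : H) => (inner ℝ f (w ω) : ℝ)) μ μ) ∧
    ∀ f : H, ∃ v : ℝ≥0, (v : ℝ) ≤ σ ^ 2 * Δ * ‖f‖ ^ 2 ∧
      μ.map (fun ω => (inner ℝ f (w ω) : ℝ)) = gaussianReal 0 v

end

end MixtureModel

/-! A deterministic inequality is combined with a Gaussian tail bound. Write ϕ_j for the j-th
arc-length derivative of the normalized features, δ for the prediction error, D for its norm, m =
ν(𝒵), and E for the penalty of the estimator minus that of the truth (both without κ). Minimality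
gives D²/(2m) + κE ≤ ⟨δ, W⟩/m.

Deterministic part (`prediction_bound_of_noise_le`). Attach each estimated parameter to the true one
within distance r, if any. Let I0, I1, I2, I3 be the ν-integrals of the errors on the local masses,
of the absolute local first moments, of the local second moments of |B̂|, and of the mass attached
to nothing. The certificate for the signs of B⋆ bounds C_N I2 + C_F I3 by E + O(D√(sm)).
Certificates for the signs of the local errors bound I0 and I1 by O(D√(sm)) + O(I2 + I3). If
|⟨ϕ_j(θ), W(z)⟩| ≤ u for j ≤ 2, a Taylor expansion at the true parameters gives ⟨δ, W⟩ ≤ u(I0 + I1 +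
I2 + I3). For u = cκm with the right c, the term κE cancels and D² ≤ O(κm√(sm)) D remains.

Probabilistic part (`exists_event_inner_le`). On the diagonal, 𝒦_T^{[j,j]} = ‖ϕ_j‖², so closeness to
the limit kernel bounds these norms for j ≤ 3. The process ⟨ϕ_j, w⟩ has arc-length derivative
⟨ϕ_{j+1}, w⟩; hence exp(b⟨ϕ_j, w⟩²) is bounded uniformly in θ by an initial value plus an integral,
whose expectation is O(1 + length). Markov's inequality then controls the supremum without chaining.
-/

namespace MixtureModel

noncomputable section

/-! ### Riemannian derivatives of the features -/

section Features

variable {H : Type*} [NormedAddCommGroup H] [InnerProductSpace ℝ H]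

/-- The speed `√g_T(θ) = ‖∂_θ ϕ(θ)‖` of the curve of normalized features. -/
def featureSpeed (Θ : Set ℝ) (φ : ℝ → H) (θ : ℝ) : ℝ := ‖derivWithin (normFeature φ) Θ θ‖

/-- Derivatives of the normalized features with respect to arc length. -/
def featureDeriv (Θ : Set ℝ) (φ : ℝ → H) : ℕ → ℝ → H
  | 0 => normFeature φ
  | j + 1 => fun θ => (featureSpeed Θ φ θ)⁻¹ • derivWithin (featureDeriv Θ φ j) Θ θ

variable {Θ : Set ℝ} {φ : ℝ → H}

lemma uniqueDiffOn_of_ordConnected (hΘ : Θ.OrdConnected) (hnt : Θ.Nontrivial) :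
    UniqueDiffOn ℝ Θ := by
  refine uniqueDiffOn_convex hΘ.convex ?_
  obtain ⟨x, hx, y, hy, hxy⟩ := hnt.exists_lt
  refine ⟨(x + y) / 2, mem_interior_iff_mem_nhds.2 ?_⟩
  exact Filter.mem_of_superset (Icc_mem_nhds (by linarith) (by linarith)) (hΘ.out hx hy)

lemma IsRegularDictionary.contDiffOn_normFeature (h : IsRegularDictionary Θ φ) :
    ContDiffOn ℝ 3 (normFeature φ) Θ := by
  have h0 : ∀ x ∈ Θ, φ x ≠ 0 := fun x hx => norm_pos_iff.1 (h.norm_pos x hx)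
  exact ((h.contDiffOn.norm ℝ h0).inv fun x hx => (h.norm_pos x hx).ne').smul h.contDiffOn

lemma IsRegularDictionary.featureSpeed_pos (h : IsRegularDictionary Θ φ) {θ : ℝ} (hθ : θ ∈ Θ) :
    0 < featureSpeed Θ φ θ :=
  lt_of_le_of_ne (norm_nonneg _) fun h0 => by
    have := h.g_pos θ hθ
    rw [featureSpeed] at h0
    rw [← h0] at this
    norm_num at this

lemma IsRegularDictionary.contDiffOn_featureSpeed (h : IsRegularDictionary Θ φ)
    (hu : UniqueDiffOn ℝ Θ) : ContDiffOn ℝ 2 (featureSpeed Θ φ) Θ :=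
  (h.contDiffOn_normFeature.derivWithin hu (by norm_num)).norm ℝ
    fun _ hx => norm_pos_iff.1 (h.featureSpeed_pos hx)

/-- Each arc-length derivative costs one order of smoothness out of three. The speed is only 𝒞²,
which suffices because it enters only once j ≥ 1. -/
lemma IsRegularDictionary.contDiffOn_featureDeriv (h : IsRegularDictionary Θ φ)
    (hu : UniqueDiffOn ℝ Θ) :
    ∀ j n : ℕ, n + j = 3 → ContDiffOn ℝ n (featureDeriv Θ φ j) Θ
  | 0, n, hn => by
    obtain rfl : n = 3 := by omega
    exact h.contDiffOn_normFeature
  | j + 1, n, hn => by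
    have ih := h.contDiffOn_featureDeriv hu j (n + 1) (by omega)
    have hs : ContDiffOn ℝ n (featureSpeed Θ φ) Θ :=
      (h.contDiffOn_featureSpeed hu).of_le (by exact_mod_cast (by omega : n ≤ 2))
    refine (hs.inv fun x hx => (h.featureSpeed_pos hx).ne').smul (ih.derivWithin hu ?_)
    norm_cast

lemma IsRegularDictionary.hasDerivWithinAt_featureDeriv (h : IsRegularDictionary Θ φ)
    (hu : UniqueDiffOn ℝ Θ) {j : ℕ} (hj : j ≤ 2) {θ : ℝ} (hθ : θ ∈ Θ) :
    HasDerivWithinAt (featureDeriv Θ φ j) (featureSpeed Θ φ θ • featureDeriv Θ φ (j + 1) θ) Θ θ := by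
  have hd : DifferentiableWithinAt ℝ (featureDeriv Θ φ j) Θ θ :=
    ((h.contDiffOn_featureDeriv hu j (3 - j) (by omega)).differentiableOn
      (by exact_mod_cast (by omega : 3 - j ≠ 0))) θ hθ
  rw [featureDeriv, smul_inv_smul₀ (h.featureSpeed_pos hθ).ne']
  exact hd.hasDerivWithinAt

lemma IsRegularDictionary.continuousOn_featureDeriv (h : IsRegularDictionary Θ φ)
    (hu : UniqueDiffOn ℝ Θ) {j : ℕ} (hj : j ≤ 3) : ContinuousOn (featureDeriv Θ φ j) Θ :=
  (h.contDiffOn_featureDeriv hu j (3 - j) (by omega)).continuousOn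

lemma IsRegularDictionary.kernelG_featureKernel (h : IsRegularDictionary Θ φ)
    (hu : UniqueDiffOn ℝ Θ) {θ : ℝ} (hθ : θ ∈ Θ) :
    kernelG Θ (featureKernel φ) θ = featureSpeed Θ φ θ ^ 2 := by
  have hd : HasDerivWithinAt (normFeature φ) (derivWithin (normFeature φ) Θ θ) Θ θ :=
    ((h.contDiffOn_normFeature.differentiableOn (by norm_num)) θ hθ).hasDerivWithinAt
  have h1 : ∀ t, partialY Θ (featureKernel φ) t θ =
      inner ℝ (normFeature φ t) (derivWithin (normFeature φ) Θ θ) := fun t => by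
    have := (hasDerivWithinAt_const θ Θ (normFeature φ t)).inner ℝ hd
    simpa [partialY, featureKernel] using this.derivWithin (hu θ hθ)
  have h2 := hd.inner ℝ (hasDerivWithinAt_const θ Θ (derivWithin (normFeature φ) Θ θ))
  simp only [kernelG, partialX, h1]
  rw [h2.derivWithin (hu θ hθ)]
  simp [featureSpeed]

lemma IsRegularDictionary.sqrt_kernelG (h : IsRegularDictionary Θ φ)
    (hu : UniqueDiffOn ℝ Θ) {θ : ℝ} (hθ : θ ∈ Θ) :
    √(kernelG Θ (featureKernel φ) θ) = featureSpeed Θ φ θ := by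
  rw [h.kernelG_featureKernel hu hθ, Real.sqrt_sq (h.featureSpeed_pos hθ).le]

/-- Dividing by g^{j/2} before differentiating removes exactly the accumulated powers of the speed.
What is differentiated is an inner product with ϕ_j, and the chain rule produces one new factor. -/
lemma IsRegularDictionary.covDerivY_featureKernel (h : IsRegularDictionary Θ φ)
    (hu : UniqueDiffOn ℝ Θ) (x : ℝ) :
    ∀ j ≤ 3, ∀ y ∈ Θ, covDerivY Θ (featureKernel φ) (featureKernel φ) j x y =
      featureSpeed Θ φ y ^ j * inner ℝ (normFeature φ x) (featureDeriv Θ φ j y)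
  | 0, _, y, _ => by simp [covDerivY, featureDeriv, featureKernel]
  | j + 1, hj, y, hy => by
    have key : ∀ v ∈ Θ, covDerivY Θ (featureKernel φ) (featureKernel φ) j x v /
        √(kernelG Θ (featureKernel φ) v) ^ j =
        inner ℝ (normFeature φ x) (featureDeriv Θ φ j v) := fun v hv => by
      rw [h.covDerivY_featureKernel hu x j (by omega) v hv, h.sqrt_kernelG hu hv,
        mul_div_cancel_left₀ _ (pow_ne_zero _ (h.featureSpeed_pos hv).ne')]
    have hd := (hasDerivWithinAt_const y Θ (normFeature φ x)).inner ℝ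
      (h.hasDerivWithinAt_featureDeriv hu (by omega : j ≤ 2) hy)
    simp only [covDerivY, partialY]
    rw [derivWithin_congr key (key y hy), hd.derivWithin (hu y hy), h.sqrt_kernelG hu hy]
    simp [inner_smul_right]
    ring

lemma IsRegularDictionary.covDeriv_featureKernel (h : IsRegularDictionary Θ φ)
    (hu : UniqueDiffOn ℝ Θ) {j : ℕ} (hj : j ≤ 3) {y : ℝ} (hy : y ∈ Θ) :
    ∀ i ≤ 3, ∀ x ∈ Θ, covDeriv Θ (featureKernel φ) (featureKernel φ) i j x y =
      featureSpeed Θ φ x ^ i * (featureSpeed Θ φ y ^ j *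
        inner ℝ (featureDeriv Θ φ i x) (featureDeriv Θ φ j y))
  | 0, _, x, _ => by simpa [covDeriv, featureDeriv] using h.covDerivY_featureKernel hu x j hj y hy
  | i + 1, hi, x, hx => by
    have key : ∀ u ∈ Θ, covDeriv Θ (featureKernel φ) (featureKernel φ) i j u y /
        √(kernelG Θ (featureKernel φ) u) ^ i = featureSpeed Θ φ y ^ j *
        inner ℝ (featureDeriv Θ φ i u) (featureDeriv Θ φ j y) := fun u hu' => by
      rw [h.covDeriv_featureKernel hu hj hy i (by omega) u hu', h.sqrt_kernelG hu hu',
        mul_div_cancel_left₀ _ (pow_ne_zero _ (h.featureSpeed_pos hu').ne')]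
    have hd := ((h.hasDerivWithinAt_featureDeriv hu (by omega : i ≤ 2) hx).inner ℝ
      (hasDerivWithinAt_const x Θ (featureDeriv Θ φ j y))).const_mul (featureSpeed Θ φ y ^ j)
    simp only [covDeriv, partialX]
    rw [derivWithin_congr key (key x hx), hd.derivWithin (hu x hx), h.sqrt_kernelG hu hx]
    simp [inner_smul_left]
    ring

/-- For x = y and i = j this is ‖ϕ_j‖², the link between bounds on kernels and variances of the
noise process. -/
lemma IsRegularDictionary.kernelDeriv_featureKernel (h : IsRegularDictionary Θ φ)
    (hu : UniqueDiffOn ℝ Θ) {i j : ℕ} (hi : i ≤ 3) (hj : j ≤ 3) {x y : ℝ} (hx : x ∈ Θ)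
    (hy : y ∈ Θ) : kernelDeriv Θ (featureKernel φ) i j x y =
      inner ℝ (featureDeriv Θ φ i x) (featureDeriv Θ φ j y) := by
  have h1 := pow_ne_zero i (h.featureSpeed_pos hx).ne'
  have h2 := pow_ne_zero j (h.featureSpeed_pos hy).ne'
  rw [kernelDeriv, h.covDeriv_featureKernel hu hj hy i hi x hx, h.sqrt_kernelG hu hx,
    h.sqrt_kernelG hu hy]
  field_simp

lemma IsRegularDictionary.norm_featureDeriv_zero (h : IsRegularDictionary Θ φ) {θ : ℝ}
    (hθ : θ ∈ Θ) : ‖featureDeriv Θ φ 0 θ‖ = 1 := by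
  simp [featureDeriv, normFeature, norm_smul, inv_mul_cancel₀ (h.norm_pos θ hθ).ne']

lemma IsRegularDictionary.norm_featureDeriv_one (h : IsRegularDictionary Θ φ) {θ : ℝ}
    (hθ : θ ∈ Θ) : ‖featureDeriv Θ φ 1 θ‖ = 1 := by
  have := (h.featureSpeed_pos hθ).ne'
  rw [featureSpeed] at this
  simp [featureDeriv, featureSpeed, norm_smul, inv_mul_cancel₀ this]

/-- A common bound for the squared norms of the first three derivatives of the features. -/
def featureBound (Θ Θinf : Set ℝ) (Kinf : ℝ → ℝ → ℝ) : ℝ :=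
  max 1 (max (2 * (supKernelDeriv Θ Θinf Kinf 2 2).toReal) (2 * (supKernelH Θ Θinf Kinf).toReal))

/-- Here y ≤ x + |y - x| ≤ 2L. The last hypothesis also excludes L = ⊥, so that `toReal` is
faithful. -/
lemma le_two_mul_toReal {x y : ℝ} {L : EReal} (hL : L < ⊤) (hx : ((|y - x| : ℝ) : EReal) ≤ L)
    (h : (x : EReal) ≤ L) : y ≤ 2 * L.toReal := by
  have hb : L ≠ ⊥ := fun h0 => by simp [h0] at h
  lift L to ℝ using ⟨hL.ne, hb⟩
  have h1 : |y - x| ≤ L := by exact_mod_cast hx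
  have h2 : x ≤ L := by exact_mod_cast h
  simp only [EReal.toReal_coe]
  linarith [le_abs_self (y - x)]

/-- Orders 0 and 1 have norm 1 by normalization and by the choice of arc length. Orders 2 and 3 are
diagonal values of 𝒦_T^{[2,2]} and h, within L_{2,2} and L_3 of limits that obey the same bounds. -/
lemma IsCloseToLimit.norm_featureDeriv_sq_le {Θinf ΘT : Set ℝ} {Kinf : ℝ → ℝ → ℝ}
    (hK : IsLimitKernel Θ Θinf Kinf) (h : IsRegularDictionary Θ φ) (hu : UniqueDiffOn ℝ Θ)
    (hT : IsCloseToLimit Θ Θinf ΘT Kinf φ) {j : ℕ} (hj : j ≤ 3) {θ : ℝ} (hθ : θ ∈ ΘT) :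
    ‖featureDeriv Θ φ j θ‖ ^ 2 ≤ featureBound Θ Θinf Kinf := by
  have hθi := hT.subset hθ
  have hθ' := hK.subset hθi
  have herr := hT.error_le
  interval_cases j
  · rw [h.norm_featureDeriv_zero hθ']; simp [featureBound]
  · rw [h.norm_featureDeriv_one hθ']; simp [featureBound]
  · refine le_trans ?_ ((le_max_left _ _).trans (le_max_right _ _))
    rw [← real_inner_self_eq_norm_sq, ← h.kernelDeriv_featureKernel hu hj hj hθ' hθ']
    refine le_two_mul_toReal (x := kernelDeriv Θ Kinf 2 2 θ θ)
      (hK.supDeriv_lt_top 2 le_rfl 2 le_rfl) ?_ ?_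
    · refine le_trans (le_trans ?_ (le_max_left _ _)) (herr.trans (min_le_left _ _))
      exact le_iSup₂_of_le 2 (Set.mem_Iic.2 le_rfl) (le_iSup₂_of_le 2 (Set.mem_Iic.2 le_rfl)
        (le_iSup₂_of_le θ hθ (le_iSup₂_of_le θ hθ le_rfl)))
    · refine le_trans (EReal.coe_le_coe_iff.2 (le_abs_self _)) ?_
      exact le_iSup₂_of_le θ hθi (le_iSup₂_of_le θ hθi le_rfl)
  · refine le_trans ?_ ((le_max_right _ _).trans (le_max_right _ _))
    rw [← real_inner_self_eq_norm_sq, ← h.kernelDeriv_featureKernel hu hj hj hθ' hθ']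
    refine le_two_mul_toReal (x := kernelH Θ Kinf θ) hK.supH_lt_top ?_ ?_
    · refine le_trans (le_trans ?_ (le_max_right _ _)) (herr.trans (min_le_right _ _))
      exact le_iSup₂_of_le θ hθ le_rfl
    · exact le_iSup₂_of_le θ hθi le_rfl

/-! ### Integration along the interval and the Taylor bound -/

lemma integral_eq_sub_of_hasDerivWithinAt {S : Set ℝ} (hS : S.OrdConnected) {f f' : ℝ → ℝ}
    (hf : ∀ x ∈ S, HasDerivWithinAt f (f' x) S x) (hf' : ContinuousOn f' S) {a b : ℝ}
    (ha : a ∈ S) (hb : b ∈ S) : ∫ t in a..b, f' t = f b - f a := by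
  have hsub : Set.uIcc a b ⊆ S := hS.uIcc_subset ha hb
  refine intervalIntegral.integral_eq_sub_of_hasDeriv_right
    (fun x hx => ((hf x (hsub hx)).continuousWithinAt).mono hsub) (fun x hx => ?_)
    (hf'.mono hsub).intervalIntegrable
  have hn : S ∈ nhds x := Filter.mem_of_superset (Icc_mem_nhds hx.1 hx.2) hsub
  exact ((hf x (hsub (Set.Ioo_subset_Icc_self hx))).hasDerivAt hn).hasDerivWithinAt

lemma abs_sub_le_mul_abs_integral {S : Set ℝ} (hS : S.OrdConnected) {f f' ρ : ℝ → ℝ} {C a b : ℝ}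
    (hf : ∀ x ∈ S, HasDerivWithinAt f (f' x) S x) (hf' : ContinuousOn f' S)
    (hρ : ContinuousOn ρ S) (hρ0 : ∀ x ∈ S, 0 ≤ ρ x) (ha : a ∈ S) (hb : b ∈ S)
    (hC : ∀ x ∈ Set.uIcc a b, |f' x| ≤ C * ρ x) :
    |f b - f a| ≤ C * |∫ t in a..b, ρ t| := by
  have hsub : Set.uIcc a b ⊆ S := hS.uIcc_subset ha hb
  have hi : IntervalIntegrable ρ volume a b := (hρ.mono hsub).intervalIntegrable
  rw [← integral_eq_sub_of_hasDerivWithinAt hS hf hf' ha hb, ← Real.norm_eq_abs]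
  have h1 := intervalIntegral.norm_integral_le_abs_of_norm_le
    (f := f') (g := fun t => C * ρ t) (μ := volume) (a := a) (b := b)
    ((ae_restrict_iff' measurableSet_uIoc).2 (Filter.Eventually.of_forall fun t ht => by
      rw [Real.norm_eq_abs]; exact hC t (Set.uIoc_subset_uIcc ht))) (hi.const_mul C)
  refine h1.trans_eq ?_
  rcases eq_or_ne a b with rfl | hab
  · simp
  -- The sign of C is not prescribed: a negative C forces ρ = 0 on the segment, and both sides
  -- vanish.
  have hC0 : 0 ≤ C ∨ ∀ x ∈ Set.uIcc a b, ρ x = 0 := by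
    by_contra! hcon
    obtain ⟨hC1, x, hx, hx0⟩ := hcon
    have := (abs_nonneg _).trans (hC x hx)
    have h2 := lt_of_le_of_ne (hρ0 x (hsub hx)) (Ne.symm hx0)
    nlinarith
  rcases hC0 with hC0 | hC0
  · rw [intervalIntegral.integral_const_mul, abs_mul, abs_of_nonneg hC0]
  · have : ∫ t in a..b, ρ t = 0 := by
      rw [intervalIntegral.integral_congr (g := fun _ => 0) fun t ht => hC0 t ht]; simp
    rw [intervalIntegral.integral_const_mul, this]; simp

/-- Second order Taylor bound along a curve parametrized with speed `ρ`. -/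
lemma abs_taylor_le {S : Set ℝ} (hS : S.OrdConnected) {x₀ x₁ x₂ ρ : ℝ → ℝ} {C a b : ℝ}
    (h₀ : ∀ t ∈ S, HasDerivWithinAt x₀ (ρ t * x₁ t) S t)
    (h₁ : ∀ t ∈ S, HasDerivWithinAt x₁ (ρ t * x₂ t) S t)
    (hx₂ : ContinuousOn x₂ S) (hρ : ContinuousOn ρ S) (hρ0 : ∀ t ∈ S, 0 ≤ ρ t)
    (hC : ∀ t ∈ S, |x₂ t| ≤ C) (ha : a ∈ S) (hb : b ∈ S) :
    |x₀ b - x₀ a - x₁ a * ∫ t in a..b, ρ t| ≤ C * |∫ t in a..b, ρ t| ^ 2 := by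
  have hx₁ : ContinuousOn x₁ S := fun t ht => (h₁ t ht).continuousWithinAt
  have hC0 : 0 ≤ C := (abs_nonneg _).trans (hC a ha)
  have hsub : Set.uIcc a b ⊆ S := hS.uIcc_subset ha hb
  have hi : ∀ {c d}, c ∈ S → d ∈ S → IntervalIntegrable ρ volume c d := fun hc hd =>
    (hρ.mono (hS.uIcc_subset hc hd)).intervalIntegrable
  -- The length up to t is replaced by the full length, which is why the final constant is C and not
  -- C/2.
  have step : ∀ t ∈ Set.uIcc a b, |x₁ t - x₁ a| ≤ C * |∫ t in a..b, ρ t| := by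
    intro t ht
    have h2 := abs_sub_le_mul_abs_integral hS h₁ (hρ.mul hx₂) hρ hρ0 ha (hsub ht) (C := C)
      fun y hy => by
        have hyS := hS.uIcc_subset ha (hsub ht) hy
        rw [abs_mul, abs_of_nonneg (hρ0 y hyS), mul_comm]
        exact mul_le_mul_of_nonneg_right (hC y hyS) (hρ0 y hyS)
    refine h2.trans (mul_le_mul_of_nonneg_left ?_ hC0)
    refine intervalIntegral.abs_integral_mono_interval (Set.uIoc_subset_uIoc_of_uIcc_subset_uIcc
      (Set.uIcc_subset_uIcc Set.left_mem_uIcc ht)) ?_ (hi ha hb)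
    refine (ae_restrict_iff' measurableSet_uIoc).2 (Filter.Eventually.of_forall fun y hy => ?_)
    exact hρ0 y (hsub (Set.uIoc_subset_uIcc hy))
  have hint : ∫ t in a..b, ρ t * (x₁ t - x₁ a) = x₀ b - x₀ a - x₁ a * ∫ t in a..b, ρ t := by
    rw [← integral_eq_sub_of_hasDerivWithinAt hS h₀ (hρ.mul hx₁) ha hb,
      ← intervalIntegral.integral_const_mul, ← intervalIntegral.integral_sub]
    · exact intervalIntegral.integral_congr fun t _ => by ring
    · exact ((hρ.mul hx₁).mono hsub).intervalIntegrable
    · exact (hi ha hb).const_mul _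
  rw [← hint, ← Real.norm_eq_abs]
  have h3 := intervalIntegral.norm_integral_le_abs_of_norm_le
    (f := fun t => ρ t * (x₁ t - x₁ a)) (g := fun t => (C * |∫ t in a..b, ρ t|) * ρ t)
    (μ := volume) (a := a) (b := b)
    ((ae_restrict_iff' measurableSet_uIoc).2 (Filter.Eventually.of_forall fun t ht => by
      have ht' := Set.uIoc_subset_uIcc ht
      rw [norm_mul, Real.norm_eq_abs, Real.norm_eq_abs, abs_of_nonneg (hρ0 t (hsub ht')), mul_comm]
      exact mul_le_mul_of_nonneg_right (step t ht') (hρ0 t (hsub ht')))) ((hi ha hb).const_mul _)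
  refine h3.trans_eq ?_
  rw [intervalIntegral.integral_const_mul, abs_mul, abs_of_nonneg (by positivity)]
  ring

end Features

/-! ### Suprema of Gaussian processes -/

section Noise

/-- Since c ≤ 1/(4v), the factor exp(cx²) at most halves the Gaussian exponent: the integrand is
below √2 ≤ 2 times the density of variance 2v. For v = 0 the law is a Dirac mass at 0. -/
lemma lintegral_exp_sq_gaussianReal_le {v : ℝ≥0} {c : ℝ} (hc : 4 * c * v ≤ 1) :
    ∫⁻ x, ENNReal.ofReal (Real.exp (c * x ^ 2)) ∂(gaussianReal 0 v) ≤ 2 := by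
  rcases eq_or_ne v 0 with rfl | hv
  · simp
  have hv0 : (0 : ℝ) < v := lt_of_le_of_ne v.2 (by exact_mod_cast hv.symm)
  have hv2 : (2 * v : ℝ≥0) ≠ 0 := by simpa using hv
  rw [gaussianReal_of_var_ne_zero _ hv,
    lintegral_withDensity_eq_lintegral_mul _ (measurable_gaussianPDF _ _) (by fun_prop)]
  have key : ∀ x : ℝ, (gaussianPDF 0 v * fun x => ENNReal.ofReal (Real.exp (c * x ^ 2))) x ≤
      2 * gaussianPDF 0 (2 * v) x := fun x => by
    rw [Pi.mul_apply, gaussianPDF, gaussianPDF, ← ENNReal.ofReal_mul (gaussianPDFReal_nonneg _ _ _),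
      ← ENNReal.ofReal_ofNat 2, ← ENNReal.ofReal_mul (by norm_num)]
    refine ENNReal.ofReal_le_ofReal ?_
    simp only [gaussianPDFReal, sub_zero, NNReal.coe_mul, NNReal.coe_ofNat]
    have h1 : √(2 * Real.pi * (2 * v)) = √2 * √(2 * Real.pi * v) := by
      rw [← Real.sqrt_mul (by norm_num)]; ring_nf
    have h2 : √(2 : ℝ) ≤ 2 := by
      rw [Real.sqrt_le_left (by norm_num)]; norm_num
    have h2' : 0 < √(2 : ℝ) := by positivity
    have h4 : 0 < √(2 * Real.pi * v) := by positivity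
    have h3 : Real.exp (-x ^ 2 / (2 * v)) * Real.exp (c * x ^ 2) ≤
        Real.exp (-x ^ 2 / (2 * (2 * v))) := by
      rw [← Real.exp_add, Real.exp_le_exp]
      have : c ≤ 1 / (4 * v) := by rw [le_div_iff₀ (by positivity)]; linarith
      have := mul_le_mul_of_nonneg_right this (sq_nonneg x)
      have e : -x ^ 2 / (2 * v) + 1 / (4 * v) * x ^ 2 = -x ^ 2 / (2 * (2 * v)) := by
        field_simp; ring
      linarith
    rw [h1, mul_inv, mul_assoc]
    calc _ ≤ (√(2 * Real.pi * v))⁻¹ * Real.exp (-x ^ 2 / (2 * (2 * v))) := by gcongr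
      _ = 1 * ((√(2 * Real.pi * v))⁻¹ * Real.exp (-x ^ 2 / (2 * (2 * v)))) := by ring
      _ ≤ (2 * (√2)⁻¹) * ((√(2 * Real.pi * v))⁻¹ * Real.exp (-x ^ 2 / (2 * (2 * v)))) := by
        gcongr
        rw [← div_eq_mul_inv, le_div_iff₀ h2']; linarith
      _ = _ := by ring
  calc _ ≤ ∫⁻ x, 2 * gaussianPDF 0 (2 * v) x := lintegral_mono key
    _ = 2 := by
      rw [lintegral_const_mul _ (measurable_gaussianPDF _ _), lintegral_gaussianPDF_eq_one _ hv2,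
        mul_one]

/-- The left side is the size of the derivative of exp(bx²) when x' = y. The bound t ≤ exp t absorbs
the polynomial factor and the arithmetic-geometric inequality separates x from y, so only marginal
laws matter afterwards. -/
lemma abs_mul_exp_sq_le {b x y : ℝ} (hb : 0 ≤ b) :
    |2 * b * x * y * Real.exp (b * x ^ 2)| ≤
      (Real.exp (4 * b * x ^ 2) + Real.exp (4 * b * y ^ 2)) / 2 := by
  have h1 : |2 * b * x * y| ≤ b * x ^ 2 + b * y ^ 2 := by
    rw [abs_le]; constructor <;> nlinarith [mul_nonneg hb (sq_nonneg (x + y)),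
      mul_nonneg hb (sq_nonneg (x - y))]
  have h2 : b * x ^ 2 + b * y ^ 2 ≤ Real.exp (b * x ^ 2 + b * y ^ 2) := by
    linarith [Real.add_one_le_exp (b * x ^ 2 + b * y ^ 2)]
  rw [abs_mul, abs_of_pos (Real.exp_pos _)]
  calc _ ≤ Real.exp (b * x ^ 2 + b * y ^ 2) * Real.exp (b * x ^ 2) := by gcongr; exact h1.trans h2
    _ = Real.exp (2 * b * x ^ 2) * Real.exp (b * y ^ 2) := by
      rw [← Real.exp_add, ← Real.exp_add]; ring_nf
    _ ≤ Real.exp (2 * b * x ^ 2) * Real.exp (2 * b * y ^ 2) := by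
      gcongr; nlinarith [mul_nonneg hb (sq_nonneg y)]
    _ ≤ (Real.exp (2 * b * x ^ 2) ^ 2 + Real.exp (2 * b * y ^ 2) ^ 2) / 2 := by
      nlinarith [sq_nonneg (Real.exp (2 * b * x ^ 2) - Real.exp (2 * b * y ^ 2))]
    _ = _ := by
      rw [← Real.exp_nat_mul, ← Real.exp_nat_mul]; push_cast; ring_nf

/-- A pathwise bound on `exp (b x²)` along a curve of speed `ρ`. -/
lemma exp_sq_le_add_lintegral {α β b : ℝ} (hb : 0 ≤ b) {x y ρ : ℝ → ℝ}
    (hx : ∀ t ∈ Set.Icc α β, HasDerivWithinAt x (ρ t * y t) (Set.Icc α β) t)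
    (hy : ContinuousOn y (Set.Icc α β)) (hρ : ContinuousOn ρ (Set.Icc α β))
    (hρ0 : ∀ t ∈ Set.Icc α β, 0 ≤ ρ t) {θ : ℝ} (hθ : θ ∈ Set.Icc α β) :
    ENNReal.ofReal (Real.exp (b * x θ ^ 2)) ≤ ENNReal.ofReal (Real.exp (4 * b * x α ^ 2)) +
      ∫⁻ t in Set.Icc α β, ENNReal.ofReal (ρ t) *
        ((ENNReal.ofReal (Real.exp (4 * b * x t ^ 2)) +
          ENNReal.ofReal (Real.exp (4 * b * y t ^ 2))) / 2) := by
  have hαβ : α ≤ β := hθ.1.trans hθ.2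
  have hα : α ∈ Set.Icc α β := ⟨le_rfl, hαβ⟩
  have hxc : ContinuousOn x (Set.Icc α β) := fun t ht => (hx t ht).continuousWithinAt
  have hF : ∀ t ∈ Set.Icc α β, HasDerivWithinAt (fun t => Real.exp (b * x t ^ 2))
      (ρ t * (2 * b * x t * y t * Real.exp (b * x t ^ 2))) (Set.Icc α β) t := fun t ht => by
    have := (((hx t ht).fun_pow 2).const_mul b).exp
    convert this using 1
    push_cast; ring
  have hFc : ContinuousOn (fun t => ρ t * (2 * b * x t * y t * Real.exp (b * x t ^ 2)))
      (Set.Icc α β) := by fun_prop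
  have hGc : ContinuousOn (fun t => ρ t * ((Real.exp (4 * b * x t ^ 2) +
      Real.exp (4 * b * y t ^ 2)) / 2)) (Set.Icc α β) := by fun_prop
  have hint := integral_eq_sub_of_hasDerivWithinAt Set.ordConnected_Icc hF hFc hα hθ
  have hsub : Set.Icc α θ ⊆ Set.Icc α β := Set.Icc_subset_Icc_right hθ.2
  have hGi : IntegrableOn (fun t => ρ t * ((Real.exp (4 * b * x t ^ 2) +
      Real.exp (4 * b * y t ^ 2)) / 2)) (Set.Icc α β) := hGc.integrableOn_Icc
  have h1 : ∫ t in α..θ, ρ t * (2 * b * x t * y t * Real.exp (b * x t ^ 2)) ≤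
      ∫ t in Set.Icc α β, ρ t * ((Real.exp (4 * b * x t ^ 2) +
      Real.exp (4 * b * y t ^ 2)) / 2) := by
    rw [intervalIntegral.integral_of_le hθ.1, ← integral_Icc_eq_integral_Ioc]
    refine (setIntegral_mono_on (hFc.mono hsub).integrableOn_Icc (hGi.mono_set hsub)
      measurableSet_Icc fun t ht => ?_).trans (setIntegral_mono_set hGi ?_ hsub.eventuallyLE)
    · exact mul_le_mul_of_nonneg_left ((le_abs_self _).trans (abs_mul_exp_sq_le hb))
        (hρ0 t (hsub ht))
    · refine (ae_restrict_iff' measurableSet_Icc).2 (Filter.Eventually.of_forall fun t ht => ?_)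
      have := hρ0 t ht
      simp only [Pi.zero_apply]; positivity
  have h2 : Real.exp (b * x θ ^ 2) ≤ Real.exp (4 * b * x α ^ 2) +
      ∫ t in Set.Icc α β, ρ t * ((Real.exp (4 * b * x t ^ 2) + Real.exp (4 * b * y t ^ 2)) / 2) := by
    -- The initial value is enlarged so that a single exponential moment, with parameter 4b, is
    -- needed throughout.
    have : Real.exp (b * x α ^ 2) ≤ Real.exp (4 * b * x α ^ 2) :=
      Real.exp_le_exp.2 (by nlinarith [mul_nonneg hb (sq_nonneg (x α))])
    linarith
  refine (ENNReal.ofReal_le_ofReal h2).trans (ENNReal.ofReal_add_le.trans ?_)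
  refine add_le_add_right (le_of_eq ?_) _
  rw [ofReal_integral_eq_lintegral_ofReal hGi]
  · refine setLIntegral_congr_fun measurableSet_Icc fun t ht => ?_
    rw [ENNReal.ofReal_mul (hρ0 t ht), ENNReal.ofReal_div_of_pos (by norm_num),
      ENNReal.ofReal_add (Real.exp_pos _).le (Real.exp_pos _).le, ENNReal.ofReal_ofNat]
  · refine (ae_restrict_iff' measurableSet_Icc).2 (Filter.Eventually.of_forall fun t ht => ?_)
    have := hρ0 t ht
    simp only [Pi.zero_apply]; positivity

variable {H : Type*} [NormedAddCommGroup H] [InnerProductSpace ℝ H]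
variable {Ω : Type*} [MeasurableSpace Ω] {μ : Measure Ω}

lemma lintegral_exp_inner_sq_le {w : Ω → H} {R M c : ℝ}
    (hw : ∀ f : H, Measurable fun ω => (inner ℝ f (w ω) : ℝ))
    (hg : ∀ f : H, ∃ v : ℝ≥0, (v : ℝ) ≤ R * ‖f‖ ^ 2 ∧
      μ.map (fun ω => (inner ℝ f (w ω) : ℝ)) = gaussianReal 0 v)
    (hR : 0 ≤ R) (hc0 : 0 ≤ c) (hc : 4 * c * (R * M) ≤ 1) {f : H} (hf : ‖f‖ ^ 2 ≤ M) :
    ∫⁻ ω, ENNReal.ofReal (Real.exp (c * (inner ℝ f (w ω) : ℝ) ^ 2)) ∂μ ≤ 2 := by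
  obtain ⟨v, hv, hmap⟩ := hg f
  rw [← lintegral_map (f := fun x : ℝ => ENNReal.ofReal (Real.exp (c * x ^ 2)))
    (by fun_prop) (hw f), hmap]
  refine lintegral_exp_sq_gaussianReal_le (le_trans ?_ hc)
  gcongr
  exact hv.trans (by gcongr)

/-- The pathwise majorant does not depend on θ. Tonelli bounds its expectation by 2 + 2 · length,
and Markov's inequality at level exp(bu²) concludes. -/
lemma exists_event_le_of_lintegral_exp_le [IsProbabilityMeasure μ] {b u α β : ℝ}
    {x y : ℝ → Ω → ℝ} {ρ : ℝ → ℝ} (hb : 0 ≤ b) (hαβ : α ≤ β)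
    (hxm : Measurable (Function.uncurry x)) (hym : Measurable (Function.uncurry y))
    (hx : ∀ ω, ∀ t ∈ Set.Icc α β,
      HasDerivWithinAt (fun t => x t ω) (ρ t * y t ω) (Set.Icc α β) t)
    (hy : ∀ ω, ContinuousOn (fun t => y t ω) (Set.Icc α β)) (hρ : ContinuousOn ρ (Set.Icc α β))
    (hρ0 : ∀ t ∈ Set.Icc α β, 0 ≤ ρ t)
    (hX : ∀ t ∈ Set.Icc α β, ∫⁻ ω, ENNReal.ofReal (Real.exp (4 * b * x t ω ^ 2)) ∂μ ≤ 2)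
    (hY : ∀ t ∈ Set.Icc α β, ∫⁻ ω, ENNReal.ofReal (Real.exp (4 * b * y t ω ^ 2)) ∂μ ≤ 2) :
    ∃ A : Set Ω, MeasurableSet A ∧
      μ.real Aᶜ ≤ 2 * (1 + ∫ t in α..β, ρ t) * Real.exp (-(b * u ^ 2)) ∧
      ∀ ω ∈ A, ∀ θ ∈ Set.Icc α β, Real.exp (b * x θ ω ^ 2) < Real.exp (b * u ^ 2) := by
  have hα : α ∈ Set.Icc α β := ⟨le_rfl, hαβ⟩
  have hxm' : ∀ t, Measurable (x t) := fun t => hxm.of_uncurry_left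
  let k := fun (t : ℝ) (ω : Ω) => (ENNReal.ofReal (Real.exp (4 * b * x t ω ^ 2)) +
    ENNReal.ofReal (Real.exp (4 * b * y t ω ^ 2))) / 2
  have hkm : Measurable (Function.uncurry k) := by
    have h1 : Measurable fun p : ℝ × Ω => ENNReal.ofReal
        (Real.exp (4 * b * (Function.uncurry x p) ^ 2)) := by fun_prop
    have h2 : Measurable fun p : ℝ × Ω => ENNReal.ofReal
        (Real.exp (4 * b * (Function.uncurry y p) ^ 2)) := by fun_prop
    exact (h1.add h2).div_const 2
  have hρm : AEMeasurable (fun p : ℝ × Ω => ENNReal.ofReal (ρ p.1))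
      ((volume.restrict (Set.Icc α β)).prod μ) :=
    ((hρ.aemeasurable measurableSet_Icc).ennreal_ofReal).comp_fst
  have hkm' : ∀ t, Measurable (k t) := fun t => hkm.of_uncurry_left
  have hx0 : Measurable fun ω => ENNReal.ofReal (Real.exp (4 * b * x α ω ^ 2)) := by
    have := hxm' α
    fun_prop
  have hprod : AEMeasurable (fun p : ℝ × Ω => ENNReal.ofReal (ρ p.1) * k p.1 p.2)
      ((volume.restrict (Set.Icc α β)).prod μ) := hρm.mul hkm.aemeasurable
  let Yv : Ω → ℝ≥0∞ := fun ω => ENNReal.ofReal (Real.exp (4 * b * x α ω ^ 2)) +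
    ∫⁻ t in Set.Icc α β, ENNReal.ofReal (ρ t) * k t ω
  have hYm : AEMeasurable Yv μ := hx0.aemeasurable.add hprod.lintegral_prod_left'
  have hIρ : 0 ≤ ∫ t in α..β, ρ t := intervalIntegral.integral_nonneg hαβ hρ0
  have hk : ∀ t ∈ Set.Icc α β, ∫⁻ ω, k t ω ∂μ ≤ 2 := fun t ht => by
    have := hxm' t
    simp only [k, ENNReal.div_eq_inv_mul]
    rw [lintegral_const_mul' _ _ (by simp), lintegral_add_left (by fun_prop)]
    calc _ ≤ (2 : ℝ≥0∞)⁻¹ * (2 + 2) := by gcongr; exacts [hX t ht, hY t ht]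
      _ = 2 := by
        rw [← two_mul, ← mul_assoc, ENNReal.inv_mul_cancel (by simp) (by simp), one_mul]
  have hYb : ∀ ω, ∀ θ ∈ Set.Icc α β, ENNReal.ofReal (Real.exp (b * x θ ω ^ 2)) ≤ Yv ω :=
    fun ω θ hθ => exp_sq_le_add_lintegral hb (hx ω) (hy ω) hρ hρ0 hθ
  clear_value k
  have hYi : ∫⁻ ω, Yv ω ∂μ ≤ ENNReal.ofReal (2 * (1 + ∫ t in α..β, ρ t)) := by
    rw [lintegral_add_left hx0, ← lintegral_lintegral_swap hprod, mul_add,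
      ENNReal.ofReal_add (by norm_num) (by positivity)]
    refine add_le_add (by simpa using hX α hα) ?_
    calc _ = ∫⁻ t in Set.Icc α β, ENNReal.ofReal (ρ t) * ∫⁻ ω, k t ω ∂μ :=
          lintegral_congr fun t => lintegral_const_mul _ (hkm' t)
      _ ≤ ∫⁻ t in Set.Icc α β, ENNReal.ofReal (ρ t) * 2 :=
          setLIntegral_mono' measurableSet_Icc fun t ht => by gcongr; exact hk t ht
      _ = _ := by
        rw [lintegral_mul_const' _ _ (by simp), ← ofReal_integral_eq_lintegral_ofReal
          hρ.integrableOn_Icc ((ae_restrict_iff' measurableSet_Icc).2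
            (Filter.Eventually.of_forall hρ0)), intervalIntegral.integral_of_le hαβ,
          ← integral_Icc_eq_integral_Ioc, mul_comm, ENNReal.ofReal_mul (by norm_num),
          ENNReal.ofReal_ofNat]
  clear_value Yv
  set e := Real.exp (b * u ^ 2) with he
  have he0 : 0 < e := Real.exp_pos _
  set N := {ω | ENNReal.ofReal e ≤ Yv ω} with hN
  -- The majorant is only known to be a.e. measurable, so the bad set is replaced by a measurable
  -- hull of equal measure.
  refine ⟨(toMeasurable μ N)ᶜ, (measurableSet_toMeasurable _ _).compl, ?_, fun ω hω θ hθ => ?_⟩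
  · rw [compl_compl, measureReal_def, measure_toMeasurable, Real.exp_neg, ← div_eq_mul_inv]
    refine ENNReal.toReal_le_of_le_ofReal (by positivity) ?_
    rw [ENNReal.ofReal_div_of_pos he0]
    refine (meas_ge_le_lintegral_div hYm (by simpa using he0) (by simp)).trans ?_
    gcongr
  · have hωN : Yv ω < ENNReal.ofReal e := not_le.1 fun h => hω (subset_toMeasurable _ _ h)
    exact (ENNReal.ofReal_lt_ofReal_iff he0).1
      ((hYb ω θ hθ).trans_lt hωN)

/-- Tail of the supremum of the Gaussian process `θ ↦ ⟨ψ(θ), w⟩` along a curve of speed `ρ`. -/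
lemma exists_event_inner_le [IsProbabilityMeasure μ] {w : Ω → H} {R M b u α β : ℝ}
    {ψ ψ' : ℝ → H} {ρ : ℝ → ℝ}
    (hw : ∀ f : H, Measurable fun ω => (inner ℝ f (w ω) : ℝ))
    (hg : ∀ f : H, ∃ v : ℝ≥0, (v : ℝ) ≤ R * ‖f‖ ^ 2 ∧
      μ.map (fun ω => (inner ℝ f (w ω) : ℝ)) = gaussianReal 0 v)
    (hR : 0 ≤ R) (hb : 0 < b) (hbM : 16 * b * (R * M) ≤ 1) (hu : 0 ≤ u) (hαβ : α ≤ β)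
    (hψ : ∀ t ∈ Set.Icc α β, HasDerivWithinAt ψ (ρ t • ψ' t) (Set.Icc α β) t)
    (hψ' : ContinuousOn ψ' (Set.Icc α β)) (hρ : ContinuousOn ρ (Set.Icc α β))
    (hρ0 : ∀ t ∈ Set.Icc α β, 0 ≤ ρ t) (hM : ∀ t ∈ Set.Icc α β, ‖ψ t‖ ^ 2 ≤ M)
    (hM' : ∀ t ∈ Set.Icc α β, ‖ψ' t‖ ^ 2 ≤ M) :
    ∃ A : Set Ω, MeasurableSet A ∧
      μ.real Aᶜ ≤ 2 * (1 + ∫ t in α..β, ρ t) * Real.exp (-(b * u ^ 2)) ∧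
      ∀ ω ∈ A, ∀ θ ∈ Set.Icc α β, |(inner ℝ (ψ θ) (w ω) : ℝ)| ≤ u := by
  have hψc : ContinuousOn ψ (Set.Icc α β) := fun t ht => (hψ t ht).continuousWithinAt
  -- Extending by the end values makes the process continuous in t on the whole line, hence jointly
  -- measurable in (t, ω).
  let ext := fun χ : ℝ → H => Set.IccExtend hαβ ((Set.Icc α β).domRestrict χ)
  have hext : ∀ χ : ℝ → H, ∀ t ∈ Set.Icc α β, ext χ t = χ t := fun χ t ht =>
    Set.IccExtend_of_mem _ _ ht
  have hmeas : ∀ χ : ℝ → H, ContinuousOn χ (Set.Icc α β) →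
      Measurable (Function.uncurry fun (t : ℝ) (ω : Ω) => (inner ℝ (ext χ t) (w ω) : ℝ)) :=
    fun χ hχ => by
      refine measurable_uncurry_of_continuous_of_measurable (fun ω => ?_) (fun t => hw _)
      exact (continuousOn_iff_continuous_domRestrict.1 hχ).Icc_extend'.inner continuous_const
  have hexp : ∀ {χ : ℝ → H}, (∀ t ∈ Set.Icc α β, ‖χ t‖ ^ 2 ≤ M) → ∀ t ∈ Set.Icc α β,
      ∫⁻ ω, ENNReal.ofReal (Real.exp (4 * b * (inner ℝ (ext χ t) (w ω) : ℝ) ^ 2)) ∂μ ≤ 2 :=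
    fun {χ} hχ t ht => by
      rw [hext χ t ht]
      -- The factor 16 of `hbM` is 4 · 4: one 4 from the Gaussian moment, one from the parameter 4b.
      exact lintegral_exp_inner_sq_le hw hg hR (by positivity) (by linarith) (hχ t ht)
  have hy : ∀ ω, ContinuousOn (fun t => (inner ℝ (ext ψ' t) (w ω) : ℝ)) (Set.Icc α β) :=
    fun ω => (hψ'.inner continuousOn_const).congr fun t ht => by rw [hext ψ' t ht]
  have hx : ∀ ω, ∀ t ∈ Set.Icc α β, HasDerivWithinAt (fun t => (inner ℝ (ext ψ t) (w ω) : ℝ))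
      (ρ t * (inner ℝ (ext ψ' t) (w ω) : ℝ)) (Set.Icc α β) t := fun ω t ht => by
    have h1 := (hψ t ht).inner ℝ (hasDerivWithinAt_const t (Set.Icc α β) (w ω))
    rw [hext ψ' t ht]
    refine (h1.congr (fun s hs => by rw [hext ψ s hs]) (by rw [hext ψ t ht])).congr_deriv ?_
    simp [inner_smul_left]
  obtain ⟨A, hA, hμA, hAb⟩ := exists_event_le_of_lintegral_exp_le (μ := μ) (u := u) hb.le hαβ
    (hmeas ψ hψc) (hmeas ψ' hψ') hx hy hρ hρ0 (hexp hM) (hexp hM')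
  refine ⟨A, hA, hμA, fun ω hω θ hθ => ?_⟩
  have h1 := Real.exp_lt_exp.1 (hAb ω hω θ hθ)
  rw [hext ψ θ hθ] at h1
  exact abs_le_of_sq_le_sq (lt_of_mul_lt_mul_left h1 hb.le).le hu

end Noise

/-! ### Norms over a finite space -/

section FiniteNorms

variable {Z : Type*} [MeasurableSpace Z] {E : Type*} [NormedAddCommGroup E] {ν : Measure Z}

lemma lpn_nonneg {p : ℝ≥0∞} (f : Z → E) : 0 ≤ lpn ν p f := ENNReal.toReal_nonneg

lemma eLpNorm_top_eq_one {v : Z → ℝ} (hν : ν ≠ 0) (hv : ∀ z, |v z| = 1) :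
    eLpNorm v ⊤ ν = 1 := by
  rw [eLpNorm_congr_norm_ae (g := fun _ => (1 : ℝ)) (Filter.Eventually.of_forall fun z => by
    simp [hv z]), eLpNorm_const _ (by simp) hν]
  simp

variable [Fintype Z]

/-- An essential bound holds at every atom of positive mass. Finiteness of Z keeps the essential
supremum finite, so `toReal` loses nothing. -/
lemma norm_le_lpn_top (f : Z → E) {z : Z} (hz : ν.real {z} ≠ 0) : ‖f z‖ ≤ lpn ν ⊤ f := by
  have hb : eLpNorm f ⊤ ν ≠ ⊤ := by
    refine (eLpNormEssSup_lt_top_of_ae_bound (C := ∑ z, ‖f z‖)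
      (Filter.Eventually.of_forall fun x => ?_)).ne
    exact Finset.single_le_sum (f := fun z => ‖f z‖) (fun _ _ => norm_nonneg _) (Finset.mem_univ x)
  have h := ae_le_eLpNormEssSup (f := f) (μ := ν)
  have h2 : ‖f z‖ₑ ≤ eLpNorm f ⊤ ν := by
    by_contra hcon
    refine hz ?_
    rw [measureReal_def, ENNReal.toReal_eq_zero_iff]
    exact Or.inl (measure_mono_null (Set.singleton_subset_iff.2 hcon) h)
  rw [lpn, ← toReal_enorm]
  exact ENNReal.toReal_mono hb h2

variable [MeasurableSingletonClass Z] [IsFiniteMeasure ν]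

lemma lpn_one_eq_sum (f : Z → E) : lpn ν 1 f = ∑ z, ν.real {z} * ‖f z‖ := by
  rw [lpn, eLpNorm_one_eq_lintegral_enorm, lintegral_fintype,
    ENNReal.toReal_sum fun z _ => ENNReal.mul_ne_top enorm_ne_top (measure_ne_top _ _)]
  simp [measureReal_def, mul_comm]

lemma lpn_two_sq_eq_sum (f : Z → E) : lpn ν 2 f ^ 2 = ∑ z, ν.real {z} * ‖f z‖ ^ 2 := by
  have h := eLpNorm_nnreal_pow_eq_lintegral (f := f) (μ := ν) (p := 2) (by norm_num)
  simp only [ENNReal.coe_ofNat, NNReal.coe_ofNat, ENNReal.rpow_ofNat] at h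
  rw [lpn, ← ENNReal.toReal_pow, h, lintegral_fintype,
    ENNReal.toReal_sum fun z _ => ENNReal.mul_ne_top (by simp) (measure_ne_top _ _)]
  simp [measureReal_def, mul_comm]

lemma eq_zero_of_eLpNorm_two_eq_zero {f : Z → E} (hf : eLpNorm f 2 ν = 0) {z : Z}
    (hz : ν.real {z} ≠ 0) : f z = 0 := by
  have h := lpn_two_sq_eq_sum (ν := ν) f
  rw [lpn, hf, ENNReal.toReal_zero, eq_comm] at h
  norm_num at h
  rw [Finset.sum_eq_zero_iff_of_nonneg fun _ _ => by positivity] at h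
  simpa [hz] using h z (Finset.mem_univ z)

lemma sum_inner_le_lpn_mul_lpn [InnerProductSpace ℝ E] (f g : Z → E) :
    ∑ z, ν.real {z} * (inner ℝ (f z) (g z) : ℝ) ≤ lpn ν 2 f * lpn ν 2 g := by
  have h1 : ∑ z, ν.real {z} * (inner ℝ (f z) (g z) : ℝ) ≤
      ∑ z, (√(ν.real {z}) * ‖f z‖) * (√(ν.real {z}) * ‖g z‖) := by
    refine Finset.sum_le_sum fun z _ => ?_
    have := real_inner_le_norm (f z) (g z)
    calc _ ≤ ν.real {z} * (‖f z‖ * ‖g z‖) := by gcongr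
      _ = (√(ν.real {z}) * √(ν.real {z})) * (‖f z‖ * ‖g z‖) := by
        rw [Real.mul_self_sqrt measureReal_nonneg]
      _ = _ := by ring
  refine (h1.trans (Real.sum_mul_le_sqrt_mul_sqrt _ _ _)).trans_eq ?_
  have h2 : ∀ f : Z → E, √(∑ z, (√(ν.real {z}) * ‖f z‖) ^ 2) = lpn ν 2 f := fun f => by
    simp only [mul_pow, Real.sq_sqrt measureReal_nonneg]
    rw [← lpn_two_sq_eq_sum, Real.sqrt_sq (lpn_nonneg _)]
  rw [h2, h2]

end FiniteNorms

/-! ### Decomposition of the estimation error around the true parameters -/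

section Decomposition

variable {ι κ : Type*} [Fintype κ] {S : Finset ι} {N : ι → Finset κ} {F : Finset κ}
  {b : κ → ℝ} {β : ι → ℝ} {d e : ι → κ → ℝ}

/-- The set N k collects the estimated indices within r of the k-th true parameter, and F the
remaining ones. The hypothesis will come from the 2r-separation and makes the sets N k disjoint. -/
lemma exists_near_far_decomposition {r : ℝ}
    (hdisj : ∀ k ∈ S, ∀ k' ∈ S, ∀ l, d k l ≤ r → d k' l ≤ r → k = k') :
    ∃ (N : ι → Finset κ) (F : Finset κ), (∀ k, ∀ l ∈ N k, d k l ≤ r) ∧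
      (∀ l ∈ F, ∀ k ∈ S, r < d k l) ∧
      ∀ f : κ → ℝ, ∑ l, f l = ∑ k ∈ S, ∑ l ∈ N k, f l + ∑ l ∈ F, f l := by
  classical
  refine ⟨fun k => Finset.univ.filter fun l => d k l ≤ r,
    Finset.univ.filter fun l => ∀ k ∈ S, r < d k l,
    fun k l hl => (Finset.mem_filter.1 hl).2, fun l hl => (Finset.mem_filter.1 hl).2, fun f => ?_⟩
  rw [← Finset.sum_biUnion, ← Finset.sum_union]
  · refine Finset.sum_congr (Finset.ext fun l => ?_).symm fun _ _ => rfl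
    simp only [Finset.mem_union, Finset.mem_biUnion, Finset.mem_filter, Finset.mem_univ, true_and,
      iff_true]
    by_contra! h
    obtain ⟨k, hk, hkl⟩ := h.2
    exact absurd (h.1 k hk) (not_lt.2 hkl)
  · refine Finset.disjoint_left.2 fun l hl hl' => ?_
    simp only [Finset.mem_biUnion, Finset.mem_filter, Finset.mem_univ, true_and] at hl hl'
    obtain ⟨k, hk, hkl⟩ := hl
    exact absurd (hl' k hk) (not_lt.2 hkl)
  · intro k hk k' hk' hne
    refine Finset.disjoint_left.2 fun l hl hl' => hne ?_
    simp only [Finset.mem_filter, Finset.mem_univ, true_and] at hl hl'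
    exact hdisj k hk k' hk' l hl hl'

/-- With p and q the values of a certificate at estimated and true parameters, |b| - bp is at least
C_N|b|d² near a true parameter and C_F|b| far from all of them. -/
lemma interpolation_gap_le
    (hdec : ∀ f : κ → ℝ, ∑ l, f l = ∑ k ∈ S, ∑ l ∈ N k, f l + ∑ l ∈ F, f l)
    {p : κ → ℝ} {q : ι → ℝ} {CN CF : ℝ} (hβ : ∀ k ∈ S, β k * q k = |β k|)
    (hN : ∀ k ∈ S, ∀ l ∈ N k, |p l| ≤ 1 - CN * d k l ^ 2) (hF : ∀ l ∈ F, |p l| ≤ 1 - CF) :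
    CN * ∑ k ∈ S, ∑ l ∈ N k, |b l| * d k l ^ 2 + CF * ∑ l ∈ F, |b l| ≤
      ∑ l, |b l| - ∑ k ∈ S, |β k| - (∑ l, b l * p l - ∑ k ∈ S, β k * q k) := by
  rw [Finset.sum_congr rfl hβ, hdec fun l => |b l|, hdec fun l => b l * p l]
  have h1 : ∑ k ∈ S, ∑ l ∈ N k, b l * p l ≤
      ∑ k ∈ S, ∑ l ∈ N k, (|b l| - CN * (|b l| * d k l ^ 2)) := by
    refine Finset.sum_le_sum fun k hk => Finset.sum_le_sum fun l hl => ?_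
    have := mul_le_mul_of_nonneg_left (hN k hk l hl) (abs_nonneg (b l))
    rw [← abs_mul] at this
    linarith [le_abs_self (b l * p l)]
  have h2 : ∑ l ∈ F, b l * p l ≤ ∑ l ∈ F, (|b l| - CF * |b l|) := by
    refine Finset.sum_le_sum fun l hl => ?_
    have := mul_le_mul_of_nonneg_left (hF l hl) (abs_nonneg (b l))
    rw [← abs_mul] at this
    linarith [le_abs_self (b l * p l)]
  simp only [Finset.sum_sub_distrib, ← Finset.mul_sum] at h1 h2
  linarith

/-- A first-order expansion around the true parameters, e being the signed distance. It serves three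
times: for P (c = 0), for Q (q = 0), and for the noise, where c is the derivative of the process. -/
lemma abs_sub_expansion_le
    (hdec : ∀ f : κ → ℝ, ∑ l, f l = ∑ k ∈ S, ∑ l ∈ N k, f l + ∑ l ∈ F, f l)
    {p : κ → ℝ} {q c : ι → ℝ} {C C' : ℝ}
    (hN : ∀ k ∈ S, ∀ l ∈ N k, |p l - q k - c k * e k l| ≤ C * d k l ^ 2)
    (hF : ∀ l ∈ F, |p l| ≤ C') :
    |(∑ l, b l * p l - ∑ k ∈ S, β k * q k) -
        ∑ k ∈ S, (q k * (∑ l ∈ N k, b l - β k) + c k * ∑ l ∈ N k, b l * e k l)| ≤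
      C * ∑ k ∈ S, ∑ l ∈ N k, |b l| * d k l ^ 2 + C' * ∑ l ∈ F, |b l| := by
  have h0 : (∑ l, b l * p l - ∑ k ∈ S, β k * q k) -
        ∑ k ∈ S, (q k * (∑ l ∈ N k, b l - β k) + c k * ∑ l ∈ N k, b l * e k l) =
      ∑ k ∈ S, ∑ l ∈ N k, b l * (p l - q k - c k * e k l) + ∑ l ∈ F, b l * p l := by
    rw [hdec fun l => b l * p l]
    have : ∀ k, ∑ l ∈ N k, b l * (p l - q k - c k * e k l) = ∑ l ∈ N k, b l * p l -
        q k * ∑ l ∈ N k, b l - c k * ∑ l ∈ N k, b l * e k l := fun k => by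
      rw [Finset.mul_sum, Finset.mul_sum, ← Finset.sum_sub_distrib, ← Finset.sum_sub_distrib]
      exact Finset.sum_congr rfl fun l _ => by ring
    rw [Finset.sum_congr rfl fun k _ => this k]
    simp only [mul_sub, Finset.sum_sub_distrib, Finset.sum_add_distrib]
    rw [Finset.sum_congr rfl fun k _ => mul_comm (q k) (β k)]
    ring
  rw [h0, Finset.mul_sum, Finset.mul_sum]
  refine (abs_add_le _ _).trans (add_le_add ((Finset.abs_sum_le_sum_abs _ _).trans
    (Finset.sum_le_sum fun k hk => ?_)) ((Finset.abs_sum_le_sum_abs _ _).trans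
    (Finset.sum_le_sum fun l hl => ?_)))
  · rw [Finset.mul_sum]
    refine (Finset.abs_sum_le_sum_abs _ _).trans (Finset.sum_le_sum fun l hl => ?_)
    rw [abs_mul]
    calc _ ≤ |b l| * (C * d k l ^ 2) := by gcongr; exact hN k hk l hl
      _ = _ := by ring
  · rw [abs_mul, mul_comm]
    gcongr
    exact hF l hl

end Decomposition

/-- The prediction bound deduced from the certificate inequalities and the noise inequality. -/
lemma prediction_bound_of_ineqs {CN CN' CF CB cN cF cB m D E κ t I0 I1 I2 I3 : ℝ}
    (hCN : 0 < CN) (hCN' : 0 < CN') (hCF : 0 < CF) (hCB : 0 < CB) (hcN : 0 < cN)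
    (hcF : 0 < cF) (hcB : 0 < cB) (hm : 0 < m) (hκ : 0 < κ) (hD : 0 ≤ D) (ht : 0 ≤ t)
    (hI2 : 0 ≤ I2) (hI3 : 0 ≤ I3)
    (h1 : CN * I2 + CF * I3 ≤ E + D * (CB * t * √m))
    (h2 : I0 ≤ D * (CB * t * √m) + (CN' * I2 + (1 - CF) * I3))
    (h3 : I1 ≤ D * (cB * t * √m) + (cN * I2 + cF * I3))
    (h4 : 1 / (2 * m) * D ^ 2 + κ * E ≤ 1 / m *
      (((CN' + cN + 1) / CN + (2 + cF) / CF)⁻¹ * κ * m * (I0 + I1 + I2 + I3))) :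
    1 / √m * D ≤ 2 * (((CN' + cN + 1) / CN + (2 + cF) / CF)⁻¹ * (CB + cB) + CB) * t * m * κ := by
  set Γ := (CN' + cN + 1) / CN + (2 + cF) / CF with hΓ
  have hΓ0 : 0 < Γ := by positivity
  have hsm : 0 < √m := Real.sqrt_pos.2 hm
  have hA : (CN' + cN + 1) * I2 ≤ (CN' + cN + 1) / CN * (CN * I2) :=
    le_of_eq (by field_simp)
  have hB : (2 + cF) * I3 ≤ (2 + cF) / CF * (CF * I3) := le_of_eq (by field_simp)
  have hA' : 0 ≤ (2 + cF) / CF * (CN * I2) := by positivity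
  have hB' : 0 ≤ (CN' + cN + 1) / CN * (CF * I3) := by positivity
  have hsum : (CN' + cN + 1) * I2 + (2 + cF) * I3 ≤ Γ * (CN * I2 + CF * I3) := by
    rw [hΓ]; linarith
  -- Adding `h2` and `h3`, the coefficient of I3 is 2 + cF - CF, and the term -CF is dropped.
  have hI : I0 + I1 + I2 + I3 ≤ D * ((CB + cB) * t * √m) + Γ * (E + D * (CB * t * √m)) := by
    have := mul_le_mul_of_nonneg_left h1 hΓ0.le
    have h5 := mul_nonneg hCF.le hI3
    linarith
  have h5 : 1 / (2 * m) * D ^ 2 ≤ κ * (Γ⁻¹ * (CB + cB) + CB) * t * √m * D := by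
    have e1 : 1 / m * (Γ⁻¹ * κ * m * (I0 + I1 + I2 + I3)) = Γ⁻¹ * κ * (I0 + I1 + I2 + I3) := by
      field_simp
    have e2 := mul_le_mul_of_nonneg_left hI (by positivity : 0 ≤ Γ⁻¹ * κ)
    -- The noise level carries Γ⁻¹ precisely so that E comes out with coefficient κ and cancels,
    -- whatever its sign.
    have e3 : Γ⁻¹ * κ * (D * ((CB + cB) * t * √m) + Γ * (E + D * (CB * t * √m))) =
        κ * (Γ⁻¹ * (CB + cB) + CB) * t * √m * D + κ * E := by
      field_simp; ring
    linarith
  rcases hD.eq_or_lt with rfl | hD0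
  · rw [mul_zero]; positivity
  have h6 : D ≤ 2 * m * (κ * (Γ⁻¹ * (CB + cB) + CB) * t * √m) := by
    have h7 : D * D ≤ (2 * m * (κ * (Γ⁻¹ * (CB + cB) + CB) * t * √m)) * D := by
      have := mul_le_mul_of_nonneg_left h5 (by positivity : 0 ≤ 2 * m)
      have e : 2 * m * (1 / (2 * m) * D ^ 2) = D * D := by field_simp
      linarith
    exact le_of_mul_le_mul_right h7 hD0
  rw [one_div, inv_mul_le_iff₀ hsm]
  linarith

/-! ### The Riemannian distance of the dictionary -/

section Distance

variable {H : Type*} [NormedAddCommGroup H] [InnerProductSpace ℝ H] {Θ : Set ℝ} {φ : ℝ → H}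

lemma IsRegularDictionary.riemDist_eq (h : IsRegularDictionary Θ φ) (hu : UniqueDiffOn ℝ Θ)
    (hΘ : Θ.OrdConnected) {x y : ℝ} (hx : x ∈ Θ) (hy : y ∈ Θ) :
    riemDist Θ (featureKernel φ) x y = |∫ t in x..y, featureSpeed Θ φ t| := by
  rw [riemDist, intervalIntegral.integral_symm, abs_neg]
  congr 1
  exact intervalIntegral.integral_congr fun t ht => h.sqrt_kernelG hu (hΘ.uIcc_subset hx hy ht)

/-- The target of the derivative certificates is thus signed arc length, the same quantity as in the
Taylor expansion of the noise. -/
lemma IsRegularDictionary.sign_mul_riemDist (h : IsRegularDictionary Θ φ) (hu : UniqueDiffOn ℝ Θ)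
    (hΘ : Θ.OrdConnected) {x y : ℝ} (hx : x ∈ Θ) (hy : y ∈ Θ) :
    Real.sign (y - x) * riemDist Θ (featureKernel φ) y x = ∫ t in x..y, featureSpeed Θ φ t := by
  have h0 : ∀ {a b : ℝ}, a ∈ Θ → b ∈ Θ → a ≤ b → 0 ≤ ∫ t in a..b, featureSpeed Θ φ t :=
    fun _ _ hab => intervalIntegral.integral_nonneg hab fun _ _ => norm_nonneg _
  rw [h.riemDist_eq hu hΘ hy hx]
  rcases lt_trichotomy x y with hxy | rfl | hxy
  · rw [Real.sign_of_pos (by linarith), intervalIntegral.integral_symm, abs_neg,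
      abs_of_nonneg (h0 hx hy hxy.le), one_mul]
  · simp
  · rw [Real.sign_of_neg (by linarith), abs_of_nonneg (h0 hy hx hxy.le),
      intervalIntegral.integral_symm]
    ring

lemma IsRegularDictionary.continuousOn_featureSpeed (h : IsRegularDictionary Θ φ)
    (hu : UniqueDiffOn ℝ Θ) : ContinuousOn (featureSpeed Θ φ) Θ :=
  (h.contDiffOn_featureSpeed hu).continuousOn

lemma IsRegularDictionary.riemDist_le_add (h : IsRegularDictionary Θ φ) (hu : UniqueDiffOn ℝ Θ)
    (hΘ : Θ.OrdConnected) {x y z : ℝ} (hx : x ∈ Θ) (hy : y ∈ Θ) (hz : z ∈ Θ) :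
    riemDist Θ (featureKernel φ) x y ≤
      riemDist Θ (featureKernel φ) x z + riemDist Θ (featureKernel φ) y z := by
  have hi : ∀ {a b : ℝ}, a ∈ Θ → b ∈ Θ → IntervalIntegrable (featureSpeed Θ φ) volume a b :=
    fun ha hb => ((h.continuousOn_featureSpeed hu).mono (hΘ.uIcc_subset ha hb)).intervalIntegrable
  rw [h.riemDist_eq hu hΘ hx hy, h.riemDist_eq hu hΘ hx hz, h.riemDist_eq hu hΘ hy hz,
    ← intervalIntegral.integral_add_adjacent_intervals (hi hx hz) (hi hz hy)]
  refine (abs_add_le _ _).trans_eq ?_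
  rw [intervalIntegral.integral_symm y z, abs_neg]

lemma IsRegularDictionary.integral_le_riemDiam (h : IsRegularDictionary Θ φ)
    (hu : UniqueDiffOn ℝ Θ) (hΘ : Θ.OrdConnected) {α β : ℝ} (hαβ : α ≤ β)
    (hsub : Set.Icc α β ⊆ Θ) :
    ∫ t in α..β, featureSpeed Θ φ t ≤ riemDiam Θ (featureKernel φ) (Set.Icc α β) := by
  have hα : α ∈ Set.Icc α β := ⟨le_rfl, hαβ⟩
  have hβ : β ∈ Set.Icc α β := ⟨hαβ, le_rfl⟩
  refine le_trans (le_abs_self _) ?_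
  rw [← h.riemDist_eq hu hΘ (hsub hα) (hsub hβ)]
  -- A real `sSup` requires boundedness; the total length bounds all distances.
  refine le_csSup ⟨|∫ t in α..β, featureSpeed Θ φ t|, ?_⟩ (Set.mem_image2_of_mem hα hβ)
  rintro _ ⟨x, hx, y, hy, rfl⟩
  rw [h.riemDist_eq hu hΘ (hsub hx) (hsub hy)]
  refine intervalIntegral.abs_integral_mono_interval (Set.uIoc_subset_uIoc_of_uIcc_subset_uIcc ?_)
    (Filter.Eventually.of_forall fun _ => norm_nonneg _) ?_
  · rw [Set.uIcc_of_le hαβ]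
    exact Set.ordConnected_Icc.uIcc_subset hx hy
  · refine ((h.continuousOn_featureSpeed hu).mono ?_).intervalIntegrable
    rwa [Set.uIcc_of_le hαβ]

end Distance

/-! ### Certificates as pointwise inequalities at the atoms of ν -/

section Certificates

variable {H : Type*} [NormedAddCommGroup H] [InnerProductSpace ℝ H] {Θ ΘT : Set ℝ} {φ : ℝ → H}
  {Z : Type*} [Fintype Z] [MeasurableSpace Z] [MeasurableSingletonClass Z] {ν : Measure Z}
  {ι : Type*} {S : Set ι} {ϑ : ι → ℝ} {r : ℝ} {s : ℕ}

/-- Certificates take targets indexed by parameter values; injectivity of ϑ on S lets signs indexed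
by k be transported to them. -/
lemma HasInterpolatingCertificates.exists_pointwise {CN CN' CF CB : ℝ}
    (h : HasInterpolatingCertificates Θ ΘT φ ν 1 ⊤ r s (ϑ '' S) CN CN' CF CB)
    (hinj : Set.InjOn ϑ S) (hν : ν ≠ 0) {v : ι → Z → ℝ} (hv : ∀ k z, |v k z| = 1) :
    ∃ P : Z → H, (∀ z, ν.real {z} ≠ 0 →
      (∀ k ∈ S, ∀ θ ∈ ΘT, riemDist Θ (featureKernel φ) (ϑ k) θ ≤ r →
        |(inner ℝ (normFeature φ θ) (P z) : ℝ)| ≤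
            1 - CN * riemDist Θ (featureKernel φ) (ϑ k) θ ^ 2 ∧
          |(inner ℝ (normFeature φ θ) (P z) : ℝ) - v k z| ≤
            CN' * riemDist Θ (featureKernel φ) (ϑ k) θ ^ 2) ∧
      (∀ θ ∈ ΘT, (∀ k ∈ S, r < riemDist Θ (featureKernel φ) (ϑ k) θ) →
        |(inner ℝ (normFeature φ θ) (P z) : ℝ)| ≤ 1 - CF)) ∧
      lpn ν 2 P ≤ CB * √(s : ℝ) * √(ν.real Set.univ) := by
  -- `Function.invFunOn` needs a nonempty index type.
  rcases isEmpty_or_nonempty ι with hι | hι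
  · have hS : S = ∅ := Set.eq_empty_of_isEmpty S
    obtain ⟨P, -, -, -, h3, h4⟩ := h.2 (fun _ _ => 1) (by simp [hS]) (by simp [hS])
    refine ⟨P, fun z hz => ⟨by simp [hS], fun θ hθ _ => ?_⟩, ?_⟩
    · exact (norm_le_lpn_top (fun z => (inner ℝ (normFeature φ θ) (P z) : ℝ)) hz).trans
        (h3 θ hθ (by simp [hS]))
    · simpa [Real.sqrt_eq_rpow] using h4
  have hVk : ∀ k ∈ S, Function.invFunOn ϑ S (ϑ k) = k := fun k hk => hinj.leftInvOn_invFunOn hk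
  obtain ⟨P, -, h1, h2, h3, h4⟩ := h.2 (fun z θ => v (Function.invFunOn ϑ S θ) z)
    (fun θs _ => measurable_of_countable _) (fun θs _ => eLpNorm_top_eq_one hν fun z => hv _ z)
  refine ⟨P, fun z hz => ⟨fun k hk θ hθ hd => ⟨?_, ?_⟩, fun θ hθ hd => ?_⟩, ?_⟩
  · exact (norm_le_lpn_top (fun z => (inner ℝ (normFeature φ θ) (P z) : ℝ)) hz).trans
      (h1 _ (Set.mem_image_of_mem _ hk) θ hθ hd)
  · have := h2 _ (Set.mem_image_of_mem _ hk) θ hθ hd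
    simp only [hVk k hk] at this
    exact (norm_le_lpn_top (fun z => (inner ℝ (normFeature φ θ) (P z) : ℝ) - v k z) hz).trans this
  · exact (norm_le_lpn_top (fun z => (inner ℝ (normFeature φ θ) (P z) : ℝ)) hz).trans
      (h3 θ hθ (by rintro _ ⟨k, hk, rfl⟩; exact hd k hk))
  · simpa [Real.sqrt_eq_rpow] using h4

lemma HasDerivativeCertificates.exists_pointwise {cN cF cB : ℝ}
    (h : HasDerivativeCertificates Θ ΘT φ ν 1 ⊤ r s (ϑ '' S) cN cF cB)
    (hinj : Set.InjOn ϑ S) (hν : ν ≠ 0) {v : ι → Z → ℝ} (hv : ∀ k z, |v k z| = 1) :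
    ∃ Q : Z → H, (∀ z, ν.real {z} ≠ 0 →
      (∀ k ∈ S, ∀ θ ∈ ΘT, riemDist Θ (featureKernel φ) (ϑ k) θ ≤ r →
        |(inner ℝ (normFeature φ θ) (Q z) : ℝ) -
            v k z * (Real.sign (θ - ϑ k) * riemDist Θ (featureKernel φ) θ (ϑ k))| ≤
          cN * riemDist Θ (featureKernel φ) (ϑ k) θ ^ 2) ∧
      (∀ θ ∈ ΘT, (∀ k ∈ S, r < riemDist Θ (featureKernel φ) (ϑ k) θ) →
        |(inner ℝ (normFeature φ θ) (Q z) : ℝ)| ≤ cF)) ∧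
      lpn ν 2 Q ≤ cB * √(s : ℝ) * √(ν.real Set.univ) := by
  rcases isEmpty_or_nonempty ι with hι | hι
  · have hS : S = ∅ := Set.eq_empty_of_isEmpty S
    obtain ⟨Q, -, -, h3, h4⟩ := h.2 (fun _ _ => 1) (by simp [hS]) (by simp [hS])
    refine ⟨Q, fun z hz => ⟨by simp [hS], fun θ hθ _ => ?_⟩, ?_⟩
    · exact (norm_le_lpn_top (fun z => (inner ℝ (normFeature φ θ) (Q z) : ℝ)) hz).trans
        (h3 θ hθ (by simp [hS]))
    · simpa [Real.sqrt_eq_rpow] using h4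
  have hVk : ∀ k ∈ S, Function.invFunOn ϑ S (ϑ k) = k := fun k hk => hinj.leftInvOn_invFunOn hk
  obtain ⟨Q, -, h1, h3, h4⟩ := h.2 (fun z θ => v (Function.invFunOn ϑ S θ) z)
    (fun θs _ => measurable_of_countable _) (fun θs _ => eLpNorm_top_eq_one hν fun z => hv _ z)
  refine ⟨Q, fun z hz => ⟨fun k hk θ hθ hd => ?_, fun θ hθ hd => ?_⟩, ?_⟩
  · have := h1 _ (Set.mem_image_of_mem _ hk) θ hθ hd
    simp only [hVk k hk] at this
    rw [← mul_assoc]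
    exact (norm_le_lpn_top (fun z => (inner ℝ (normFeature φ θ) (Q z) : ℝ) -
      v k z * Real.sign (θ - ϑ k) * riemDist Θ (featureKernel φ) θ (ϑ k)) hz).trans this
  · exact (norm_le_lpn_top (fun z => (inner ℝ (normFeature φ θ) (Q z) : ℝ)) hz).trans
      (h3 θ hθ (by rintro _ ⟨k, hk, rfl⟩; exact hd k hk))
  · simpa [Real.sqrt_eq_rpow] using h4

end Certificates

/-! ### The prediction bound on the event where the noise is controlled -/

section Prediction

/-- A sign with values in `{-1, 1}`. -/
def unitSign (x : ℝ) : ℝ := if 0 ≤ x then 1 else -1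

lemma abs_unitSign (x : ℝ) : |unitSign x| = 1 := by
  unfold unitSign; split_ifs <;> simp

lemma unitSign_mul_self (x : ℝ) : unitSign x * x = |x| := by
  unfold unitSign
  split_ifs with h
  · rw [one_mul, abs_of_nonneg h]
  · rw [neg_one_mul, abs_of_neg (not_le.1 h)]

lemma sum_measure_mul_le {Z : Type*} [Fintype Z] [MeasurableSpace Z] {ν : Measure Z} {f g : Z → ℝ}
    (h : ∀ z, ν.real {z} ≠ 0 → f z ≤ g z) :
    ∑ z, ν.real {z} * f z ≤ ∑ z, ν.real {z} * g z := by
  refine Finset.sum_le_sum fun z _ => ?_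
  rcases eq_or_ne (ν.real {z}) 0 with h0 | h0
  · simp [h0]
  · exact mul_le_mul_of_nonneg_left (h z h0) measureReal_nonneg

variable {H : Type*} [NormedAddCommGroup H] [InnerProductSpace ℝ H] {Θ ΘT : Set ℝ} {φ : ℝ → H}

lemma IsRegularDictionary.abs_inner_taylor_le (h : IsRegularDictionary Θ φ)
    (hu : UniqueDiffOn ℝ Θ) (hsub : ΘT ⊆ Θ) (hT : ΘT.OrdConnected) {w : H} {u : ℝ}
    (hw : ∀ t ∈ ΘT, |(inner ℝ (featureDeriv Θ φ 2 t) w : ℝ)| ≤ u) {x y : ℝ} (hx : x ∈ ΘT)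
    (hy : y ∈ ΘT) :
    |(inner ℝ (featureDeriv Θ φ 0 y) w : ℝ) - inner ℝ (featureDeriv Θ φ 0 x) w -
        inner ℝ (featureDeriv Θ φ 1 x) w * ∫ t in x..y, featureSpeed Θ φ t| ≤
      u * |∫ t in x..y, featureSpeed Θ φ t| ^ 2 := by
  have hd : ∀ j ≤ 1, ∀ t ∈ ΘT, HasDerivWithinAt (fun t => (inner ℝ (featureDeriv Θ φ j t) w : ℝ))
      (featureSpeed Θ φ t * inner ℝ (featureDeriv Θ φ (j + 1) t) w) ΘT t := fun j hj t ht => by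
    have := ((h.hasDerivWithinAt_featureDeriv hu (by omega : j ≤ 2) (hsub ht)).mono hsub).inner ℝ
      (hasDerivWithinAt_const t ΘT w)
    refine this.congr_deriv ?_
    simp [inner_smul_left]
  exact abs_taylor_le hT (hd 0 (by norm_num)) (hd 1 le_rfl)
    (((h.continuousOn_featureDeriv hu (by norm_num)).mono hsub).inner continuousOn_const)
    ((h.continuousOn_featureSpeed hu).mono hsub) (fun t _ => norm_nonneg _) hw hx hy

variable {Z : Type*} [Fintype Z] [MeasurableSpace Z] [MeasurableSingletonClass Z] {ν : Measure Z}
  [IsFiniteMeasure ν]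

/-- The basic inequality satisfied by an estimator. -/
lemma IsEstimator.basic_inequality {K : ℕ} {κ : ℝ} {Y W : Z → H} {B Bs : Fin K → Z → ℝ}
    {ϑ ϑs : Fin K → ℝ} (h : IsEstimator ΘT φ ν 1 κ Y B ϑ) (hBs : ∀ k, MemLp (Bs k) 2 ν)
    (hϑs : ∀ k, ϑs k ∈ ΘT) (hν : 0 < ν.real Set.univ)
    (hY : ∀ᵐ z ∂ν, Y z = mixture φ Bs ϑs z + W z) :
    1 / (2 * ν.real Set.univ) * lpn ν 2 (fun z => mixture φ B ϑ z - mixture φ Bs ϑs z) ^ 2 +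
        κ * (∑ z, ν.real {z} * ∑ k, |B k z| - ∑ z, ν.real {z} * ∑ k, |Bs k z|) ≤
      1 / ν.real Set.univ *
        ∑ z, ν.real {z} * (inner ℝ (mixture φ B ϑ z - mixture φ Bs ϑs z) (W z) : ℝ) := by
  have hmin := h.2.2 Bs ϑs hBs hϑs
  have hYz : ∀ z, ν.real {z} ≠ 0 → Y z = mixture φ Bs ϑs z + W z := fun z hz => by
    by_contra hcon
    refine hz ?_
    rw [measureReal_def, ENNReal.toReal_eq_zero_iff]
    exact Or.inl (measure_mono_null (Set.singleton_subset_iff.2 hcon) hY)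
  have hpen : ∀ B : Fin K → Z → ℝ, ∑ k, lpn ν 1 (B k) = ∑ z, ν.real {z} * ∑ k, |B k z| :=
    fun B => by
      simp only [lpn_one_eq_sum, Finset.mul_sum, Real.norm_eq_abs]
      exact Finset.sum_comm
  have hexp : lpn ν 2 (fun z => Y z - mixture φ B ϑ z) ^ 2 =
      lpn ν 2 (fun z => Y z - mixture φ Bs ϑs z) ^ 2 +
        lpn ν 2 (fun z => mixture φ B ϑ z - mixture φ Bs ϑs z) ^ 2 -
        2 * ∑ z, ν.real {z} * (inner ℝ (mixture φ B ϑ z - mixture φ Bs ϑs z) (W z) : ℝ) := by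
    simp only [lpn_two_sq_eq_sum]
    rw [Finset.mul_sum, ← Finset.sum_add_distrib, ← Finset.sum_sub_distrib]
    refine Finset.sum_congr rfl fun z _ => ?_
    rcases eq_or_ne (ν.real {z}) 0 with h0 | h0
    · simp [h0]
    · have e1 : Y z - mixture φ B ϑ z = W z - (mixture φ B ϑ z - mixture φ Bs ϑs z) := by
        rw [hYz z h0]; abel
      have e2 : Y z - mixture φ Bs ϑs z = W z := by rw [hYz z h0]; abel
      rw [e1, e2, norm_sub_sq_real, real_inner_comm (W z)]
      ring
  rw [penalizedRisk, penalizedRisk, hpen, hpen, hexp] at hmin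
  have e : ∀ a b c : ℝ, 1 / (2 * ν.real Set.univ) * (a + b - 2 * c) =
      1 / (2 * ν.real Set.univ) * a + 1 / (2 * ν.real Set.univ) * b - 1 / ν.real Set.univ * c :=
    fun a b c => by field_simp
  rw [e] at hmin
  linarith

lemma inner_mixture_sub {K : ℕ} {B Bs : Fin K → ℝ} {ϑ ϑs : Fin K → ℝ} {S : Finset (Fin K)}
    (hS : ∀ k ∉ S, Bs k = 0) (p : H) :
    (inner ℝ (∑ k, B k • normFeature φ (ϑ k) - ∑ k, Bs k • normFeature φ (ϑs k)) p : ℝ) =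
      ∑ l, B l * (inner ℝ (normFeature φ (ϑ l)) p : ℝ) -
        ∑ k ∈ S, Bs k * (inner ℝ (normFeature φ (ϑs k)) p : ℝ) := by
  rw [inner_sub_left, sum_inner, sum_inner]
  simp only [inner_smul_left, conj_trivial]
  congr 1
  exact (Finset.sum_subset (Finset.subset_univ S) fun k _ hk => by rw [hS k hk, zero_mul]).symm

/-- The signs fed to the certificates depend on the estimator, hence on the noise. This is harmless
because certificates exist for every sign pattern and the argument is carried out for one fixed
realization. -/
theorem prediction_bound_of_noise_le (h : IsRegularDictionary Θ φ)
    (hu : UniqueDiffOn ℝ Θ) (hΘ : Θ.OrdConnected) (hsub : ΘT ⊆ Θ) (hT : ΘT.OrdConnected)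
    (hν : ν ≠ 0) {r : ℝ} {s K : ℕ} {CN CN' CF CB cN cF cB κ : ℝ} (hr : 0 < r)
    (hCN : 0 < CN) (hCN' : 0 < CN') (hCF : 0 < CF)
    (hCB : 0 < CB) (hcN : 0 < cN) (hcF : 0 < cF) (hcB : 0 < cB) (hκ : 0 < κ)
    {Y W : Z → H} {B Bs : Fin K → Z → ℝ} {ϑ ϑs : Fin K → ℝ}
    (hBs : ∀ k, MemLp (Bs k) 2 ν) (hϑs : ∀ k, ϑs k ∈ ΘT) (hs : (support ν Bs).ncard = s)
    (hP : HasInterpolatingCertificates Θ ΘT φ ν 1 ⊤ r s (ϑs '' support ν Bs) CN CN' CF CB)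
    (hQ : HasDerivativeCertificates Θ ΘT φ ν 1 ⊤ r s (ϑs '' support ν Bs) cN cF cB)
    (hY : ∀ᵐ z ∂ν, Y z = mixture φ Bs ϑs z + W z)
    (hW : ∀ j ≤ 2, ∀ θ ∈ ΘT, ∀ z, |(inner ℝ (featureDeriv Θ φ j θ) (W z) : ℝ)| ≤
      ((CN' + cN + 1) / CN + (2 + cF) / CF)⁻¹ * κ * ν.real Set.univ)
    (hest : IsEstimator ΘT φ ν 1 κ Y B ϑ) :
    1 / √(ν.real Set.univ) * lpn ν 2 (fun z => mixture φ B ϑ z - mixture φ Bs ϑs z) ≤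
      2 * (((CN' + cN + 1) / CN + (2 + cF) / CF)⁻¹ * (CB + cB) + CB) * √(s : ℝ) *
        ν.real Set.univ * κ := by
  classical
  have hm : 0 < ν.real Set.univ := by
    rw [measureReal_def]
    exact ENNReal.toReal_pos (by simpa using hν) (measure_ne_top _ _)
  -- The support and its image both have cardinal s.
  have hinj : Set.InjOn ϑs (support ν Bs) :=
    Set.injOn_of_ncard_image_eq (by rw [hP.1.ncard_eq, hs]) (Set.toFinite _)
  obtain ⟨S, hS⟩ : ∃ S : Finset (Fin K), (S : Set (Fin K)) = support ν Bs :=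
    (Set.toFinite _).exists_finset_coe
  rw [← hS] at hinj hP hQ
  have hmem : ∀ {k}, k ∈ S ↔ k ∈ support ν Bs := fun {k} => by rw [← hS, Finset.mem_coe]
  set D := riemDist Θ (featureKernel φ) with hD
  have hϑ := hest.2.1
  have hsep : ∀ k ∈ S, ∀ k' ∈ S, ∀ l, D (ϑs k) (ϑ l) ≤ r → D (ϑs k') (ϑ l) ≤ r → k = k' := by
    intro k hk k' hk' l h1 h2
    by_contra hne
    have h3 := hP.1.separated _ (Set.mem_image_of_mem _ hk) _ (Set.mem_image_of_mem _ hk')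
      (fun e => hne (hinj hk hk' e))
    have h4 := h.riemDist_le_add hu hΘ (hsub (hϑs k)) (hsub (hϑs k')) (hsub (hϑ l))
    linarith
  obtain ⟨N, F, hNm, hFm, hdec⟩ := exists_near_far_decomposition (κ := Fin K) hsep
  set e : Fin K → Fin K → ℝ := fun k l => ∫ t in (ϑs k)..(ϑ l), featureSpeed Θ φ t
  have hDe : ∀ k l, D (ϑs k) (ϑ l) = |e k l| := fun k l =>
    h.riemDist_eq hu hΘ (hsub (hϑs k)) (hsub (hϑ l))
  have hD0 : ∀ k, D (ϑs k) (ϑs k) = 0 := fun k => by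
    rw [hD, h.riemDist_eq hu hΘ (hsub (hϑs k)) (hsub (hϑs k))]; simp
  have hSz : ∀ z, ν.real {z} ≠ 0 → ∀ k ∉ S, Bs k z = 0 := fun z hz k hk => by
    have : eLpNorm (Bs k) 2 ν = 0 := by
      by_contra hcon
      exact hk (hmem.2 hcon)
    exact eq_zero_of_eLpNorm_two_eq_zero this hz
  set δ : Z → H := fun z => mixture φ B ϑ z - mixture φ Bs ϑs z
  have hin : ∀ z, ν.real {z} ≠ 0 → ∀ p : H, (inner ℝ (δ z) p : ℝ) =
      ∑ l, B l z * (inner ℝ (normFeature φ (ϑ l)) p : ℝ) -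
        ∑ k ∈ S, Bs k z * (inner ℝ (normFeature φ (ϑs k)) p : ℝ) := fun z hz p =>
    inner_mixture_sub (hSz z hz) p
  have hCS : ∀ {P : Z → H} {C : ℝ}, lpn ν 2 P ≤ C * √(s : ℝ) * √(ν.real Set.univ) →
      ∑ z, ν.real {z} * (inner ℝ (δ z) (P z) : ℝ) ≤
        lpn ν 2 δ * (C * √(s : ℝ) * √(ν.real Set.univ)) := fun hP' =>
    (sum_inner_le_lpn_mul_lpn _ _).trans (mul_le_mul_of_nonneg_left hP' (lpn_nonneg _))
  -- Integrands of I0, …, I3: error on local mass, local first moment, local second moment, far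
  -- mass.
  let i0 : Z → ℝ := fun z => ∑ k ∈ S, |∑ l ∈ N k, B l z - Bs k z|
  let i1 : Z → ℝ := fun z => ∑ k ∈ S, |∑ l ∈ N k, B l z * e k l|
  let i2 : Z → ℝ := fun z => ∑ k ∈ S, ∑ l ∈ N k, |B l z| * D (ϑs k) (ϑ l) ^ 2
  let i3 : Z → ℝ := fun z => ∑ l ∈ F, |B l z|
  -- At distance 0 the quadratic bounds become exact interpolation at the true parameters.
  have hp0 : ∀ {x c C : ℝ}, |x - c| ≤ C * (0 : ℝ) ^ 2 → x = c := fun hx => by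
    norm_num at hx; linarith
  have e1 : ∀ (c : ℝ) (f : Z → ℝ), ∑ z, ν.real {z} * (c * f z) = c * ∑ z, ν.real {z} * f z :=
    fun c f => by rw [Finset.mul_sum]; exact Finset.sum_congr rfl fun z _ => by ring
  -- the certificate interpolating the signs of the true coefficients
  have hI1 : CN * ∑ z, ν.real {z} * i2 z + CF * ∑ z, ν.real {z} * i3 z ≤
      (∑ z, ν.real {z} * ∑ k, |B k z| - ∑ z, ν.real {z} * ∑ k, |Bs k z|) +
        lpn ν 2 δ * (CB * √(s : ℝ) * √(ν.real Set.univ)) := by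
    obtain ⟨P, hP1, hP2⟩ := hP.exists_pointwise hinj hν (v := fun k z => - unitSign (-Bs k z))
      fun k z => by rw [abs_neg, abs_unitSign]
    rw [← hD] at hP1
    -- The gap inequality contains -⟨δ, P⟩, so Cauchy–Schwarz is applied to -P.
    have key : ∑ z, ν.real {z} * (CN * i2 z + CF * i3 z) ≤ ∑ z, ν.real {z} *
        (∑ k, |B k z| - ∑ k, |Bs k z| + (inner ℝ (δ z) (-P z) : ℝ)) := by
      refine sum_measure_mul_le fun z hz => ?_
      have hq : ∀ k ∈ S, Bs k z * (inner ℝ (normFeature φ (ϑs k)) (P z) : ℝ) = |Bs k z| := by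
        intro k hk
        have := ((hP1 z hz).1 k hk (ϑs k) (hϑs k) (by rw [hD0]; exact hr.le)).2
        rw [hD0] at this
        rw [hp0 this, ← abs_neg (Bs k z), ← unitSign_mul_self]
        ring
      have h1 := interpolation_gap_le (b := fun l => B l z) (β := fun k => Bs k z)
        (d := fun k l => D (ϑs k) (ϑ l)) hdec hq
        (p := fun l => (inner ℝ (normFeature φ (ϑ l)) (P z) : ℝ)) (CN := CN) (CF := CF)
        (fun k hk l hl => ((hP1 z hz).1 k hk _ (hϑ l) (hNm k l hl)).1)
        (fun l hl => (hP1 z hz).2 _ (hϑ l) (hFm l hl))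
      rw [← hin z hz] at h1
      have h2 : ∑ k, |Bs k z| = ∑ k ∈ S, |Bs k z| :=
        (Finset.sum_subset (Finset.subset_univ S) fun k _ hk => by
          rw [hSz z hz k hk, abs_zero]).symm
      rw [inner_neg_right, h2]
      linarith
    have hP3 : lpn ν 2 (fun z => -P z) ≤ CB * √(s : ℝ) * √(ν.real Set.univ) := by
      have : lpn ν 2 (fun z => -P z) = lpn ν 2 P := by
        rw [lpn, lpn]; exact congrArg _ (eLpNorm_neg P 2 ν)
      rwa [this]
    have hcs := hCS hP3
    simp only [mul_add, mul_sub, Finset.sum_add_distrib, Finset.sum_sub_distrib] at key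
    rw [e1, e1] at key
    linarith
  -- the certificate interpolating the signs of the local errors
  have hI0 : ∑ z, ν.real {z} * i0 z ≤ lpn ν 2 δ * (CB * √(s : ℝ) * √(ν.real Set.univ)) +
      (CN' * ∑ z, ν.real {z} * i2 z + (1 - CF) * ∑ z, ν.real {z} * i3 z) := by
    obtain ⟨P, hP1, hP2⟩ := hP.exists_pointwise hinj hν
      (v := fun k z => unitSign (∑ l ∈ N k, B l z - Bs k z)) fun k z => abs_unitSign _
    rw [← hD] at hP1
    have key : ∑ z, ν.real {z} * i0 z ≤ ∑ z, ν.real {z} *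
        ((inner ℝ (δ z) (P z) : ℝ) + (CN' * i2 z + (1 - CF) * i3 z)) := by
      refine sum_measure_mul_le fun z hz => ?_
      have hq : ∀ k ∈ S, (inner ℝ (normFeature φ (ϑs k)) (P z) : ℝ) =
          unitSign (∑ l ∈ N k, B l z - Bs k z) := fun k hk => by
        have := ((hP1 z hz).1 k hk (ϑs k) (hϑs k) (by rw [hD0]; exact hr.le)).2
        rw [hD0] at this
        exact hp0 this
      have h1 := abs_sub_expansion_le (b := fun l => B l z) (β := fun k => Bs k z)
        (d := fun k l => D (ϑs k) (ϑ l)) (e := e) hdec (c := fun _ => 0)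
        (q := fun k => (inner ℝ (normFeature φ (ϑs k)) (P z) : ℝ))
        (p := fun l => (inner ℝ (normFeature φ (ϑ l)) (P z) : ℝ)) (C := CN') (C' := 1 - CF)
        (fun k hk l hl => by
          rw [zero_mul, sub_zero, hq k hk]
          exact ((hP1 z hz).1 k hk _ (hϑ l) (hNm k l hl)).2)
        (fun l hl => (hP1 z hz).2 _ (hϑ l) (hFm l hl))
      rw [← hin z hz] at h1
      have h2 : ∑ k ∈ S, ((inner ℝ (normFeature φ (ϑs k)) (P z) : ℝ) *
          (∑ l ∈ N k, B l z - Bs k z) + 0 * ∑ l ∈ N k, B l z * e k l) = i0 z :=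
        Finset.sum_congr rfl fun k hk => by
          rw [hq k hk, unitSign_mul_self, zero_mul, add_zero]
      rw [h2] at h1
      linarith [(abs_le.1 h1).1]
    have hcs := hCS hP2
    simp only [mul_add, Finset.sum_add_distrib] at key
    rw [e1, e1] at key
    linarith
  -- the derivative certificate
  have hI1' : ∑ z, ν.real {z} * i1 z ≤ lpn ν 2 δ * (cB * √(s : ℝ) * √(ν.real Set.univ)) +
      (cN * ∑ z, ν.real {z} * i2 z + cF * ∑ z, ν.real {z} * i3 z) := by
    obtain ⟨P, hP1, hP2⟩ := hQ.exists_pointwise hinj hν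
      (v := fun k z => unitSign (∑ l ∈ N k, B l z * e k l)) fun k z => abs_unitSign _
    rw [← hD] at hP1
    have key : ∑ z, ν.real {z} * i1 z ≤ ∑ z, ν.real {z} *
        ((inner ℝ (δ z) (P z) : ℝ) + (cN * i2 z + cF * i3 z)) := by
      refine sum_measure_mul_le fun z hz => ?_
      have hq : ∀ k ∈ S, (inner ℝ (normFeature φ (ϑs k)) (P z) : ℝ) = 0 := fun k hk => by
        have := (hP1 z hz).1 k hk (ϑs k) (hϑs k) (by rw [hD0]; exact hr.le)
        rw [hD0] at this
        simpa using hp0 this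
      have h1 := abs_sub_expansion_le (b := fun l => B l z) (β := fun k => Bs k z)
        (d := fun k l => D (ϑs k) (ϑ l)) (e := e) hdec
        (c := fun k => unitSign (∑ l ∈ N k, B l z * e k l))
        (q := fun k => (inner ℝ (normFeature φ (ϑs k)) (P z) : ℝ))
        (p := fun l => (inner ℝ (normFeature φ (ϑ l)) (P z) : ℝ)) (C := cN) (C' := cF)
        (fun k hk l hl => by
          have h3 := (hP1 z hz).1 k hk _ (hϑ l) (hNm k l hl)
          rw [h.sign_mul_riemDist hu hΘ (hsub (hϑs k)) (hsub (hϑ l))] at h3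
          rw [hq k hk, sub_zero]
          exact h3)
        (fun l hl => (hP1 z hz).2 _ (hϑ l) (hFm l hl))
      rw [← hin z hz] at h1
      have h2 : ∑ k ∈ S, ((inner ℝ (normFeature φ (ϑs k)) (P z) : ℝ) *
          (∑ l ∈ N k, B l z - Bs k z) + unitSign (∑ l ∈ N k, B l z * e k l) *
            ∑ l ∈ N k, B l z * e k l) = i1 z :=
        Finset.sum_congr rfl fun k hk => by
          rw [hq k hk, unitSign_mul_self, zero_mul, zero_add]
      rw [h2] at h1
      linarith [(abs_le.1 h1).1]
    have hcs := hCS hP2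
    simp only [mul_add, Finset.sum_add_distrib] at key
    rw [e1, e1] at key
    linarith
  -- the noise
  set u := ((CN' + cN + 1) / CN + (2 + cF) / CF)⁻¹ * κ * ν.real Set.univ
  have hnoise : ∑ z, ν.real {z} * (inner ℝ (δ z) (W z) : ℝ) ≤
      u * (∑ z, ν.real {z} * i0 z + ∑ z, ν.real {z} * i1 z + ∑ z, ν.real {z} * i2 z +
        ∑ z, ν.real {z} * i3 z) := by
    have key : ∑ z, ν.real {z} * (inner ℝ (δ z) (W z) : ℝ) ≤
        ∑ z, ν.real {z} * (u * (i0 z + i1 z + i2 z + i3 z)) := by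
      refine sum_measure_mul_le fun z hz => ?_
      -- The noise plays the role of a certificate: orders 0 and 1 at the true parameters give i0
      -- and i1, the order 2 remainder gives i2, and far indices give i3.
      have h1 := abs_sub_expansion_le (b := fun l => B l z) (β := fun k => Bs k z)
        (d := fun k l => D (ϑs k) (ϑ l)) (e := e) hdec
        (c := fun k => (inner ℝ (featureDeriv Θ φ 1 (ϑs k)) (W z) : ℝ))
        (q := fun k => (inner ℝ (normFeature φ (ϑs k)) (W z) : ℝ))
        (p := fun l => (inner ℝ (normFeature φ (ϑ l)) (W z) : ℝ)) (C := u) (C' := u)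
        (fun k hk l hl => by
          simp only [hDe]
          exact h.abs_inner_taylor_le hu hsub hT (fun t ht => hW 2 le_rfl t ht z) (hϑs k) (hϑ l))
        (fun l _ => hW 0 (by norm_num) _ (hϑ l) z)
      rw [← hin z hz] at h1
      have h2 : ∑ k ∈ S, ((inner ℝ (normFeature φ (ϑs k)) (W z) : ℝ) *
          (∑ l ∈ N k, B l z - Bs k z) + (inner ℝ (featureDeriv Θ φ 1 (ϑs k)) (W z) : ℝ) *
            ∑ l ∈ N k, B l z * e k l) ≤ u * (i0 z + i1 z) := by
        rw [← Finset.sum_add_distrib, Finset.mul_sum]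
        refine Finset.sum_le_sum fun k _ => ?_
        have hb : ∀ {a c : ℝ}, |a| ≤ u → a * c ≤ u * |c| := fun ha =>
          (le_abs_self _).trans (by rw [abs_mul]; gcongr)
        rw [mul_add]
        exact add_le_add (hb (hW 0 (by norm_num) _ (hϑs k) z)) (hb (hW 1 (by norm_num) _ (hϑs k) z))
      linarith [(abs_le.1 h1).2]
    rw [e1] at key
    simpa only [mul_add, Finset.sum_add_distrib] using key
  have hbasic := hest.basic_inequality hBs hϑs hm hY
  refine prediction_bound_of_ineqs hCN hCN' hCF hCB hcN hcF hcB hm hκ (lpn_nonneg _)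
    (Real.sqrt_nonneg _) ?_ ?_ hI1 hI0 hI1' (hbasic.trans ?_)
  · exact Finset.sum_nonneg fun z _ => mul_nonneg measureReal_nonneg
      (Finset.sum_nonneg fun _ _ => Finset.sum_nonneg fun _ _ => by positivity)
  · exact Finset.sum_nonneg fun z _ => mul_nonneg measureReal_nonneg
      (Finset.sum_nonneg fun _ _ => abs_nonneg _)
  · exact mul_le_mul_of_nonneg_left hnoise (by positivity)

end Prediction

/-! ### The event where the noise is controlled -/

section NoiseEvent

variable {H : Type*} [NormedAddCommGroup H] [InnerProductSpace ℝ H] {Θ : Set ℝ} {φ : ℝ → H}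
  {Ω : Type*} [MeasurableSpace Ω] {μ : Measure Ω} {Z : Type*}

lemma IsAdmissibleNoise.exists_gaussianReal {W : Ω → Z → H} {σ Δ : ℝ}
    (h : IsAdmissibleNoise μ W σ Δ) (z : Z) (f : H) : ∃ v : ℝ≥0, (v : ℝ) ≤ σ ^ 2 * Δ * ‖f‖ ^ 2 ∧
      μ.map (fun ω => (inner ℝ f (W ω z) : ℝ)) = gaussianReal 0 v := by
  obtain ⟨w, -, -, -, hid, hg⟩ := h
  obtain ⟨v, hv, hmap⟩ := hg f
  exact ⟨v, hv, by rw [← hmap]; exact ((hid z).comp (measurable_pi_apply f)).map_eq⟩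

/-- A union bound over the points of Z and three orders j, whence 6 = 3 · 2. Norm bounds are needed
up to order 3 because the order j process is driven by order j + 1. -/
lemma exists_event_forall_inner_le [IsProbabilityMeasure μ] [Fintype Z] (h : IsRegularDictionary Θ φ) (hu : UniqueDiffOn ℝ Θ)
    {W : Ω → Z → H} {σ Δ M b u α β : ℝ} (hσ : 0 < σ) (hΔ : 0 < Δ)
    (hW : IsAdmissibleNoise μ W σ Δ) (hb : 0 < b) (hbM : 16 * b * (σ ^ 2 * Δ * M) ≤ 1)
    (hu0 : 0 ≤ u) (hαβ : α ≤ β) (hsub : Set.Icc α β ⊆ Θ)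
    (hM : ∀ j ≤ 3, ∀ θ ∈ Set.Icc α β, ‖featureDeriv Θ φ j θ‖ ^ 2 ≤ M) :
    ∃ A : Set Ω, MeasurableSet A ∧
      μ.real Aᶜ ≤ 6 * (Fintype.card Z : ℝ) * (1 + ∫ t in α..β, featureSpeed Θ φ t) *
        Real.exp (-(b * u ^ 2)) ∧
      ∀ ω ∈ A, ∀ j ≤ 2, ∀ θ ∈ Set.Icc α β, ∀ z,
        |(inner ℝ (featureDeriv Θ φ j θ) (W ω z) : ℝ)| ≤ u := by
  have hev : ∀ (z : Z) (j : Fin 3), ∃ A : Set Ω, MeasurableSet A ∧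
      μ.real Aᶜ ≤ 2 * (1 + ∫ t in α..β, featureSpeed Θ φ t) * Real.exp (-(b * u ^ 2)) ∧
      ∀ ω ∈ A, ∀ θ ∈ Set.Icc α β, |(inner ℝ (featureDeriv Θ φ j θ) (W ω z) : ℝ)| ≤ u :=
    fun z j => by
      have hj := j.is_lt
      refine exists_event_inner_le (w := fun ω => W ω z) (ψ' := featureDeriv Θ φ (j + 1))
        (hW.choose_spec.2.1 z) (hW.exists_gaussianReal z) (by positivity) hb hbM hu0 hαβ
        (fun t ht => (h.hasDerivWithinAt_featureDeriv hu (by omega) (hsub ht)).mono hsub)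
        ((h.continuousOn_featureDeriv hu (by omega)).mono hsub)
        ((h.continuousOn_featureSpeed hu).mono hsub) (fun t _ => norm_nonneg _)
        (hM j (by omega)) (hM (j + 1) (by omega))
  choose A hA hμ hAu using hev
  refine ⟨⋂ z, ⋂ j, A z j, MeasurableSet.iInter fun z => MeasurableSet.iInter fun j => hA z j, ?_,
    fun ω hω j hj θ hθ z => ?_⟩
  · simp only [Set.compl_iInter]
    calc μ.real (⋃ z, ⋃ j, (A z j)ᶜ) ≤ ∑ z, ∑ j, μ.real (A z j)ᶜ :=
          (measureReal_iUnion_fintype_le _).trans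
            (Finset.sum_le_sum fun z _ => measureReal_iUnion_fintype_le _)
      _ ≤ ∑ _z : Z, ∑ _j : Fin 3,
          2 * (1 + ∫ t in α..β, featureSpeed Θ φ t) * Real.exp (-(b * u ^ 2)) :=
          Finset.sum_le_sum fun z _ => Finset.sum_le_sum fun j _ => hμ z j
      _ = _ := by simp; ring
  · simp only [Set.mem_iInter] at hω
    exact hAu z ⟨j, by omega⟩ ω (hω z _) θ hθ

/-- The constant 32 = 2 · 16 makes the exponent at least 2 log τ. -/
lemma exp_neg_le_inv_sq {M c C R ℓ τ u : ℝ} (hM : 0 < M) (hR : 0 < R) (hc : 0 < c)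
    (hC : C = c⁻¹ * √(32 * M)) (hτ : 1 < τ) (hℓ : ℓ = Real.log τ)
    (hu : c * (C * √(R * ℓ)) ≤ u) :
    Real.exp (-(1 / (16 * R * M) * u ^ 2)) ≤ (τ ^ 2)⁻¹ := by
  have hℓ0 : 0 < ℓ := hℓ ▸ Real.log_pos hτ
  have hτ0 : 0 < τ := by linarith
  have h1 : √(32 * M) * √(R * ℓ) ≤ u := by
    rw [hC] at hu
    have : c * (c⁻¹ * √(32 * M) * √(R * ℓ)) = √(32 * M) * √(R * ℓ) := by field_simp
    linarith
  have h2 : 32 * M * (R * ℓ) ≤ u ^ 2 := by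
    have := pow_le_pow_left₀ (by positivity) h1 2
    rwa [mul_pow, Real.sq_sqrt (by positivity), Real.sq_sqrt (by positivity)] at this
  have h3 : 2 * ℓ ≤ 1 / (16 * R * M) * u ^ 2 := by
    rw [one_div, le_inv_mul_iff₀ (by positivity)]
    linarith
  calc _ ≤ Real.exp (-(2 * ℓ)) := Real.exp_le_exp.2 (by linarith)
    _ = _ := by
      rw [Real.exp_neg, hℓ, two_mul, Real.exp_add, Real.exp_log hτ0, sq]

/-- Since √(log τ) ≤ τ, the factor τ⁻² is below both 1/τ and 1/(τ√(log τ)). -/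
lemma one_add_mul_inv_sq_le {L D τ : ℝ} (hL : 0 ≤ L) (hLD : L ≤ D) (hτ : 1 < τ) :
    (1 + L) * (τ ^ 2)⁻¹ ≤ 2 * max (D / (τ * √(Real.log τ))) (1 / τ) := by
  have hτ0 : 0 < τ := by linarith
  have hlog : 0 < Real.log τ := Real.log_pos hτ
  have h1 : √(Real.log τ) ≤ τ := by
    rw [Real.sqrt_le_left hτ0.le]
    nlinarith [Real.log_le_sub_one_of_pos hτ0]
  have h2 : (τ ^ 2)⁻¹ ≤ 1 / τ := by
    rw [one_div]; exact inv_anti₀ hτ0 (by nlinarith)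
  have h3 : L * (τ ^ 2)⁻¹ ≤ D / (τ * √(Real.log τ)) := by
    rw [div_eq_mul_inv]
    refine mul_le_mul hLD (inv_anti₀ (by positivity) ?_) (by positivity) (hL.trans hLD)
    rw [sq]; gcongr
  have h4 := le_max_left (D / (τ * √(Real.log τ))) (1 / τ)
  have h5 := le_max_right (D / (τ * √(Real.log τ))) (1 / τ)
  linarith

end NoiseEvent

end

end MixtureModel

/-! ### Choice of the constants and conclusion -/

theorem corollary2
    (Θ Θinf : Set ℝ) (hΘ : Θ.OrdConnected) (hΘnt : Θ.Nontrivial)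
    (Kinf : ℝ → ℝ → ℝ) (hKinf : MixtureModel.IsLimitKernel Θ Θinf Kinf)
    (r : ℝ) (hr : 0 < r)
    (CN CN' CF CB cN cF cB : ℝ) (hCN : 0 < CN) (hCN' : 0 < CN') (hCF : 0 < CF) (hCF1 : CF < 1)
    (hCB : 0 < CB) (hcN : 0 < cN) (hcF : 0 < cF) (hcB : 0 < cB) :
    ∃ C₀ C₃ C₄ : ℝ, 0 < C₀ ∧ 0 < C₃ ∧ 0 < C₄ ∧
      ∀ (H : Type*) [NormedAddCommGroup H] [InnerProductSpace ℝ H] [CompleteSpace H]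
        (φ : ℝ → H) (ΘT : Set ℝ)
        (Z : Type*) [Fintype Z] [MeasurableSpace Z] [MeasurableSingletonClass Z]
        (a : Z → ℝ≥0) (ν : Measure Z) (K : ℕ) (s : ℕ)
        (Bstar : Fin K → Z → ℝ) (ϑstar : Fin K → ℝ)
        (Ω : Type*) [MeasurableSpace Ω] (μ : Measure Ω) [IsProbabilityMeasure μ]
        (W Y : Ω → Z → H) (σ Δ : ℝ),
        ν = ∑ z, (a z : ℝ≥0∞) • Measure.dirac z → ν ≠ 0 →
        MixtureModel.IsRegularDictionary Θ φ →
        MixtureModel.IsCloseToLimit Θ Θinf ΘT Kinf φ →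
        (∀ k, MemLp (Bstar k) 2 ν) → (∀ k, ϑstar k ∈ ΘT) →
        (MixtureModel.support ν Bstar).ncard = s → 1 ≤ s →
        MixtureModel.HasInterpolatingCertificates Θ ΘT φ ν 1 ⊤ r s
          (ϑstar '' MixtureModel.support ν Bstar) CN CN' CF CB →
        MixtureModel.HasDerivativeCertificates Θ ΘT φ ν 1 ⊤ r s
          (ϑstar '' MixtureModel.support ν Bstar) cN cF cB →
        0 < σ → 0 < Δ → MixtureModel.IsAdmissibleNoise μ W σ Δ →
        (∀ᵐ ω ∂μ, ∀ᵐ z ∂ν, Y ω z = MixtureModel.mixture φ Bstar ϑstar z + W ω z) →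
        ∀ τ κ : ℝ, 1 < τ → C₃ * σ * √(Δ * Real.log τ) / ν.real Set.univ ≤ κ →
          ∃ A : Set Ω, MeasurableSet A ∧
            1 - C₄ * (Fintype.card Z : ℝ) *
                max (MixtureModel.riemDiam Θ (MixtureModel.featureKernel φ) ΘT /
                  (τ * √(Real.log τ))) (1 / τ) ≤ μ.real A ∧
            ∀ ω ∈ A, ∀ (Bhat : Fin K → Z → ℝ) (ϑhat : Fin K → ℝ),
              MixtureModel.IsEstimator ΘT φ ν 1 κ (Y ω) Bhat ϑhat →
              1 / √(ν.real Set.univ) *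
                  MixtureModel.lpn ν 2 (fun z => MixtureModel.mixture φ Bhat ϑhat z -
                    MixtureModel.mixture φ Bstar ϑstar z) ≤
                C₀ * √(s : ℝ) * ν.real Set.univ * κ := by
  have hu := MixtureModel.uniqueDiffOn_of_ordConnected hΘ hΘnt
  set M := MixtureModel.featureBound Θ Θinf Kinf
  have hM : 0 < M := lt_of_lt_of_le one_pos (le_max_left _ _)
  set c := ((CN' + cN + 1) / CN + (2 + cF) / CF)⁻¹
  have hc : 0 < c := by positivity
  -- The first constant is that of the prediction bound, the second brings the noise level cκm up to
  -- √(32 M σ²Δ log τ), and 12 = 6 · 2 joins the union bound to `one_add_mul_inv_sq_le`.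
  refine ⟨2 * (c * (CB + cB) + CB), c⁻¹ * √(32 * M), 12, by positivity, by positivity,
    by norm_num, ?_⟩
  intro H _ _ _ φ ΘT Z _ _ _ a ν K s Bs ϑs Ω _ μ _ W Y σ Δ hν hν0 hφ hT hBs hϑs hs hs1 hP hQ
    hσ hΔ hW hY τ κ hτ hκ
  have hfin : IsFiniteMeasure ν := ⟨by simp [hν]⟩
  have hm : 0 < ν.real Set.univ := by
    rw [measureReal_def]
    exact ENNReal.toReal_pos (by simpa using hν0) (measure_ne_top _ _)
  have hsub : ΘT ⊆ Θ := hT.subset.trans hKinf.subset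
  have hne : ΘT.Nonempty := by
    have : (MixtureModel.support ν Bs).Nonempty := by
      rw [Set.nonempty_iff_ne_empty]
      intro h0
      rw [h0, Set.ncard_empty] at hs
      omega
    exact ⟨_, hϑs this.some⟩
  obtain ⟨α, β, rfl⟩ : ∃ α β, ΘT = Set.Icc α β :=
    ⟨_, _, eq_Icc_of_connected_compact ⟨hne, hT.ordConnected.isPreconnected⟩ hT.isCompact⟩
  have hαβ : α ≤ β := Set.nonempty_Icc.1 hne
  have hlog : 0 < Real.log τ := Real.log_pos hτ
  have hR : 0 < σ ^ 2 * Δ := by positivity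
  have hκ' : c⁻¹ * √(32 * M) * √(σ ^ 2 * Δ * Real.log τ) ≤ κ * ν.real Set.univ := by
    rw [div_le_iff₀ hm] at hκ
    rwa [mul_assoc (σ ^ 2), Real.sqrt_mul (sq_nonneg σ), Real.sqrt_sq hσ.le, ← mul_assoc]
  have hκ0 : 0 < κ := by
    refine lt_of_lt_of_le ?_ hκ
    positivity
  obtain ⟨A, hA, hμA, hAu⟩ := MixtureModel.exists_event_forall_inner_le (M := M)
    (b := 1 / (16 * (σ ^ 2 * Δ) * M)) (u := c * κ * ν.real Set.univ) hφ hu hσ hΔ hW (by positivity)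
    (le_of_eq (by field_simp)) (by positivity) hαβ hsub
    (fun j hj θ hθ => hT.norm_featureDeriv_sq_le hKinf hφ hu hj hθ)
  have hexp := MixtureModel.exp_neg_le_inv_sq (u := c * κ * ν.real Set.univ) hM hR hc rfl hτ rfl
    (by rw [mul_assoc c κ]; exact mul_le_mul_of_nonneg_left hκ' hc.le)
  have hL0 : 0 ≤ ∫ t in α..β, MixtureModel.featureSpeed Θ φ t :=
    intervalIntegral.integral_nonneg hαβ fun _ _ => norm_nonneg _
  have hmax := MixtureModel.one_add_mul_inv_sq_le hL0
    (hφ.integral_le_riemDiam hu hΘ hαβ hsub) hτ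
  -- The model equation holds only almost surely; a measurable null set is removed from the event.
  obtain ⟨G, hGsub, hGm, hG0⟩ := exists_measurable_superset_of_null (ae_iff.1 hY)
  refine ⟨A ∩ Gᶜ, hA.inter hGm.compl, ?_, fun ω hω Bh ϑh hest => ?_⟩
  · have h1 : μ.real (A ∩ Gᶜ)ᶜ ≤ μ.real Aᶜ := by
      rw [Set.compl_inter, compl_compl]
      refine (measureReal_union_le _ _).trans_eq ?_
      rw [measureReal_def μ G, hG0, ENNReal.toReal_zero, add_zero]
    rw [probReal_compl_eq_one_sub (hA.inter hGm.compl)] at h1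
    have h2 : μ.real Aᶜ ≤ 6 * (Fintype.card Z : ℝ) *
        ((1 + ∫ t in α..β, MixtureModel.featureSpeed Θ φ t) * (τ ^ 2)⁻¹) := by
      rw [← mul_assoc]
      exact hμA.trans (mul_le_mul_of_nonneg_left hexp (by positivity))
    have h3 := mul_le_mul_of_nonneg_left hmax (by positivity : 0 ≤ 6 * (Fintype.card Z : ℝ))
    linarith
  · have hYω : ∀ᵐ z ∂ν, Y ω z = MixtureModel.mixture φ Bs ϑs z + W ω z := by
      by_contra hcon
      exact hω.2 (hGsub hcon)
    exact MixtureModel.prediction_bound_of_noise_le hφ hu hΘ hsub hT.ordConnected hν0 hr hCN hCN'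
      hCF hCB hcN hcF hcB hκ0 hBs hϑs hs hP hQ hYω (hAu ω hω.1) hest
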